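/- **Setting.** Write $\mathbb S^4=\mathbb R^4\cup\{\infty\}$, $\mathbb R^3_+=\{(x_1,x_2,x_3,0):x_3\ge 0\}$, $R_\theta(x)=(x_1,x_2,x_3\cos\theta-x_4\sin\theta,x_3\sin\theta+x_4\cos\theta)$, and $Spin(X)=\{R_\theta(x):x\in X,\ 0\le\theta\le 2\pi\}$ for $X\subset\mathbb R^3_+$. A *pearl* is a round 3-sphere $\Sigma\subset\mathbb R^4$ of positive radius; the closed ball it bounds is its *solid pearl*. Two pearls (or the balls they bound) are *orthogonal* if the square of the distance between their centres equals the sum of the squares of their radii. A *spinnable arc* $A\subset\mathbb R^3_+$ is a smoothly embedded arc with exactly its (distinct) end-points in the plane $x_3=x_4=0$, having contact of infinite order with the normal line to that plane at each end-point. It is *knotted* if its union with the straight segment joining its end-points is a non-trivial knot in $\mathbb R^3$. A *semi-pearl solid necklace* subordinate to $A$ is a finite sequence of closed round 4-balls with centres in $\mathbb R^3_+$, such that the first and last are centred at the end-points $A(0),A(1)$ of $A$; the balls cover $A$; consecutive balls are orthogonal and non-consecutive ones are disjoint; and the segment of $A$ lying in the interior of each ball is unknotted (the 3-dimensional slice of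 the ball by $\mathbb R^3_+$ together with the closure of this segment is homeomorphic to a 3-ball with a diameter). Let $A$ be a knotted spinnable arc. A *pearl-necklace* $Spin(T)$ subordinate to $Spin(A)$ is the following finite family of pearls, where $i\in\mathbb Z/6$ and $l\ge 1$. 1. Pearls $\Sigma^k_i=R_{2\pi i/6}(\Sigma^k)$ for $1\le k\le l$, where $\Sigma^0,\dots,\Sigma^{l+1}$ bound the balls of a semi-pearl solid necklace subordinate to $A$; it is required that $\Sigma^k_i$ be orthogonal to $\Sigma^k_{i+1}$. 2. Two pearls $\Sigma_1,\Sigma_2$ centred at $A(0),A(1)$, orthogonal to all $\Sigma^1_i$ and to all $\Sigma^l_i$ respectively, with $\Sigma_1\cap\Sigma^1_i\cap\Sigma^1_{i+1}\ne\emptyset$ and $\Sigma_2\cap\Sigma^l_i\cap\Sigma^l_{i+1}\neq\emptyset$ for all $i$. 3. For each $1\le k<l$ and each $i$, a pearl $P^k_i$ orthogonal to $\Sigma^k_i,\Sigma^{k+1}_i,\Sigma^k_{i+1},\Sigma^{k+1}_{i+1}$ (hence passing through the common point of these four pearls), whose solid pearl is disjoint from the solid pearls of all other members of the necklace. 4.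 For each $\Sigma^k_i$ with solid pearl $B^k_i$, the intersection $B^k_i\cap Spin(A)$ is an unknotted disk in $B^k_i$: the pair is homeomorphic to a 4-ball with a flat equatorial disk. Let $\Sigma_1,\dots,\Sigma_n$ be all the pearls of $Spin(T)$, let $B_j$ be the solid pearl of $\Sigma_j$, let $|Spin(T)|=\bigcup_j B_j$, let $I_j$ be the inversion of $\mathbb S^4$ in $\Sigma_j$, and let $\Gamma=\langle I_1,\dots,I_n\rangle$. For a group $G$ of homeomorphisms of $\mathbb S^4$, let $\Omega(G)$ be the set of points with a neighbourhood $U$ such that $U\cap g(U)=\emptyset$ for all but finitely many $g\in G$. The group is *Kleinian* if it is a discrete group of conformal diffeomorphisms of $\mathbb S^4$ (orientation-reversing ones allowed) with $\Omega(G)\ne\emptyset$. A set $D\subset\Omega(G)$ is a *fundamental domain* for $G$ if - $D$ lies in the closure of its interior, and its closure in $\Omega(G)$ is a codimension-zero submanifold with piecewise smooth boundary (locally a smooth manifold with corners); - the translates of the closure of $D$ in $\Omega(G)$ cover $\Omega(G)$; - $g(\operatorname{int}D)\cap \operatorname{int}D=\emptyset$ for all $g\in G\setminus\{e\}$; - the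 boundary of $D$ in $\Omega(G)$ is a locally finite union of smooth codimension-one submanifolds with corners, closed in $\Omega(G)$ and called faces, no face containing a nonempty relatively open part of another; each face $S$ is assigned a face $F$, and $F$ is assigned $S$, with an element $g_{SF}\in G\setminus\{e\}$ such that $g_{SF}S=F$ and $g_{SF}=g_{FS}^{-1}$; - only finitely many translates of $D$ meet any given compact subset of $\Omega(G)$. **Proposition.** For every pearl-necklace $Spin(T)$ subordinate to $Spin(A)$, with $A$ a knotted spinnable arc, the group $\Gamma$ is discrete and Kleinian; $\mathbb S^4\setminus|Spin(T)|$ is a fundamental domain for $\Gamma$; and $\Gamma$ has the presentation $$\Gamma=\langle I_1,\dots,I_n \mid I_j^2\ (1\le j\le n),\ (I_iI_j)^2\ \text{whenever } \Sigma_i,\Sigma_j \text{ are orthogonal}\rangle .$$ -/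

import Mathlib

open Set Filter Topology Manifold
open scoped ContDiff

noncomputable section

/-- Euclidean four-space. -/
abbrev R4 : Type := EuclideanSpace ℝ (Fin 4)

/-- The four-sphere `ℝ⁴ ∪ {∞}`. -/
abbrev S4 : Type := OnePoint R4

/-! ## Round balls and inversions -/

/-- A round ball of `ℝ⁴`. Its boundary sphere is a pearl, and the closed ball a solid pearl. -/
structure RoundBall where
  center : R4
  radius : ℝ
  radius_pos : 0 < radius

namespace RoundBall

/-- The solid pearl. -/
def solid (B : RoundBall) : Set R4 := Metric.closedBall B.center B.radius

/-- The open ball. -/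
def inner (B : RoundBall) : Set R4 := Metric.ball B.center B.radius

/-- The pearl. -/
def sphere (B : RoundBall) : Set R4 := Metric.sphere B.center B.radius

/-- Two pearls are orthogonal if the square of the distance between their centres is the sum of
the squares of their radii. -/
def Orthogonal (B B' : RoundBall) : Prop :=
  dist B.center B'.center ^ 2 = B.radius ^ 2 + B'.radius ^ 2

open Classical in
/-- Inversion in the boundary sphere as a map of `ℝ⁴ ∪ {∞}`: it exchanges the centre and `∞`. -/
def reflectionFun (B : RoundBall) (x : S4) : S4 :=
  x.elim (B.center : S4) fun y =>
    if y = B.center then OnePoint.infty else ((EuclideanGeometry.inversion B.center B.radius y : R4) : S4)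

lemma reflectionFun_infty (B : RoundBall) : B.reflectionFun OnePoint.infty = (B.center : S4) := rfl

lemma reflectionFun_center (B : RoundBall) : B.reflectionFun (B.center : S4) = OnePoint.infty := by
  simp [reflectionFun]

lemma reflectionFun_coe (B : RoundBall) {y : R4} (hy : y ≠ B.center) :
    B.reflectionFun (y : S4) = ((EuclideanGeometry.inversion B.center B.radius y : R4) : S4) := by
  simp [reflectionFun, hy]

lemma reflectionFun_involutive (B : RoundBall) : Function.Involutive B.reflectionFun := by
  intro x
  induction x using OnePoint.rec with
  | infty => rw [reflectionFun_infty, reflectionFun_center]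
  | coe y =>
    have hr := B.radius_pos.ne'
    by_cases hy : y = B.center
    · rw [hy, reflectionFun_center, reflectionFun_infty]
    · rw [reflectionFun_coe B hy, reflectionFun_coe B
        (by rwa [Ne, EuclideanGeometry.inversion_eq_center hr]),
        EuclideanGeometry.inversion_inversion _ hr]

lemma tendsto_inversion_cobounded (B : RoundBall) :
    Tendsto (EuclideanGeometry.inversion B.center B.radius) (Bornology.cobounded R4)
      (𝓝 B.center) := by
  rw [tendsto_iff_dist_tendsto_zero]
  simp_rw [EuclideanGeometry.dist_inversion_center]
  exact tendsto_const_nhds.div_atTop (Metric.tendsto_dist_right_cobounded_atTop B.center)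

lemma continuous_reflectionFun (B : RoundBall) : Continuous B.reflectionFun := by
  rw [OnePoint.continuous_iff]
  constructor
  · rw [reflectionFun_infty, coclosedCompact_eq_cocompact, ← Metric.cobounded_eq_cocompact]
    have h1 := (OnePoint.continuous_coe.tendsto B.center).comp B.tendsto_inversion_cobounded
    refine h1.congr' ?_
    have h2 : ∀ᶠ y in Bornology.cobounded R4, y ≠ B.center := by
      rw [Metric.cobounded_eq_cocompact]
      exact (isCompact_singleton (x := B.center)).compl_mem_cocompact
    filter_upwards [h2] with y hy
    exact (reflectionFun_coe B hy).symm
  · rw [continuous_iff_continuousAt]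
    intro y
    by_cases hy : y = B.center
    · subst hy
      rw [ContinuousAt, reflectionFun_center, ← nhdsNE_sup_pure, tendsto_sup]
      constructor
      · have h1 := EuclideanGeometry.tendsto_inversion_nhdsNE_center_cobounded
          (c := B.center) B.radius_pos.ne'
        rw [Metric.cobounded_eq_cocompact, ← coclosedCompact_eq_cocompact] at h1
        refine (OnePoint.tendsto_coe_infty.comp h1).congr' ?_
        filter_upwards [self_mem_nhdsWithin] with y hy
        exact (reflectionFun_coe B hy).symm
      · rw [tendsto_pure_left]
        intro s hs
        rw [reflectionFun_center]
        exact mem_of_mem_nhds hs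
    · have h1 : ContinuousAt (EuclideanGeometry.inversion B.center B.radius) y :=
        continuousAt_const.inversion continuousAt_const continuousAt_id hy
      refine (OnePoint.continuous_coe.continuousAt.comp h1).congr ?_
      filter_upwards [isOpen_ne.mem_nhds hy] with z hz
      exact (reflectionFun_coe B hz).symm

/-- Reflection (inversion) of the four-sphere in a pearl. -/
def reflection (B : RoundBall) : S4 ≃ₜ S4 where
  toFun := B.reflectionFun
  invFun := B.reflectionFun
  left_inv := B.reflectionFun_involutive
  right_inv := B.reflectionFun_involutive
  continuous_toFun := B.continuous_reflectionFun
  continuous_invFun := B.continuous_reflectionFun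

/-- The unit ball. -/
def unit : RoundBall := ⟨0, 1, one_pos⟩

end RoundBall

/-! ## The smooth and conformal structure of the four-sphere -/

/-- The identity chart on `ℝ⁴ ⊂ ℝ⁴ ∪ {∞}`. -/
def finiteChart : OpenPartialHomeomorph S4 R4 :=
  (OnePoint.isOpenEmbedding_coe.toOpenPartialHomeomorph ((↑) : R4 → S4)).symm

/-- The chart around `∞` given by `x ↦ x / ‖x‖²`. -/
def inftyChart : OpenPartialHomeomorph S4 R4 :=
  RoundBall.unit.reflection.toOpenPartialHomeomorph.trans finiteChart

open Classical in
instance : ChartedSpace R4 S4 where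
  atlas := {finiteChart, inftyChart}
  chartAt x := if x = OnePoint.infty then inftyChart else finiteChart
  mem_chart_source x := by
    split_ifs with h
    · subst h
      have h : RoundBall.unit.reflection OnePoint.infty = ((0 : R4) : S4) := rfl
      simp [inftyChart, finiteChart, h]
    · simpa [finiteChart, OnePoint.ne_infty_iff_exists] using h
  chart_mem_atlas x := by
    split_ifs <;> simp

/-- The two charts form a smooth atlas. -/
instance : IsManifold 𝓘(ℝ, R4) ∞ S4 := by
  apply isManifold_of_contDiffOn
  have key : ContDiffOn ℝ ∞ (EuclideanGeometry.inversion (0 : R4) 1) {0}ᶜ :=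
    contDiffOn_const.inversion contDiffOn_const contDiffOn_id fun x hx => hx
  have hJ : ∀ y : R4, y ≠ 0 → RoundBall.unit.reflection (y : S4) =
      ((EuclideanGeometry.inversion (0 : R4) 1 y : R4) : S4) := fun y hy =>
    RoundBall.unit.reflectionFun_coe hy
  have hJ0 : RoundBall.unit.reflection ((0 : R4) : S4) = OnePoint.infty :=
    RoundBall.unit.reflectionFun_center
  have hf : ∀ y : R4, finiteChart (y : S4) = y := fun y =>
    OnePoint.isOpenEmbedding_coe.toOpenPartialHomeomorph_left_inv
  have hfs : ∀ y : R4, finiteChart.symm y = (y : S4) := fun _ => rfl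
  have hi : ∀ x : S4, inftyChart x = finiteChart (RoundBall.unit.reflection x) := fun _ => rfl
  have his : ∀ y : R4, inftyChart.symm y = RoundBall.unit.reflection (y : S4) := fun _ => rfl
  have hJJ : ∀ x : S4, RoundBall.unit.reflection (RoundBall.unit.reflection x) = x :=
    RoundBall.unit.reflectionFun_involutive
  have hfin : OnePoint.infty ∉ finiteChart.source := by simp [finiteChart]
  rintro e e' (rfl | rfl) (rfl | rfl)
  · exact contDiffOn_id.congr fun y _ => by simp [hf, hfs]
  · have h0 : ∀ y ∈ (finiteChart.symm ≫ₕ inftyChart).source, y ≠ 0 := by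
      rintro y hy rfl
      have h1 : RoundBall.unit.reflection ((0 : R4) : S4) ∈ finiteChart.source := by
        simpa [inftyChart, hfs] using hy.2
      exact hfin (hJ0 ▸ h1)
    refine (key.mono fun y hy => h0 y (by simpa using hy.1)).congr fun y hy => ?_
    simp [hfs, hi, hJ y (h0 y (by simpa using hy.1)), hf]
  · have h0 : ∀ y ∈ (inftyChart.symm ≫ₕ finiteChart).source, y ≠ 0 := by
      rintro y hy rfl
      have h1 : RoundBall.unit.reflection ((0 : R4) : S4) ∈ finiteChart.source := by
        simpa [his] using hy.2
      exact hfin (hJ0 ▸ h1)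
    refine (key.mono fun y hy => h0 y (by simpa using hy.1)).congr fun y hy => ?_
    simp [his, hJ y (h0 y (by simpa using hy.1)), hf]
  · exact contDiffOn_id.congr fun y _ => by simp [his, hi, hJJ, hf]

/-- The differential of a self-map of the four-sphere, read in the charts. -/
def sphereDeriv (f : S4 → S4) (x : S4) : R4 →L[ℝ] R4 :=
  mfderiv 𝓘(ℝ, R4) 𝓘(ℝ, R4) f x

/-- The differential of a real function on the four-sphere, read in the charts. -/
def scalarDeriv (f : S4 → ℝ) (x : S4) : R4 →L[ℝ] ℝ :=
  mfderiv 𝓘(ℝ, R4) 𝓘(ℝ, ℝ) f x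

/-- Möbius transformations: conformal diffeomorphisms of the four-sphere. The round metric is
conformal to the Euclidean metric in both charts, so conformality is tested in charts. -/
def IsMobius (f : S4 ≃ₜ S4) : Prop :=
  ContMDiff 𝓘(ℝ, R4) 𝓘(ℝ, R4) ∞ f ∧ ContMDiff 𝓘(ℝ, R4) 𝓘(ℝ, R4) ∞ f.symm ∧
    ∀ x : S4, IsConformalMap (sphereDeriv f x)

/-! ## Kleinian groups -/

/-- Discreteness for the topology of uniform convergence on the (compact) four-sphere. -/
def IsDiscreteGroup (G : Subgroup (S4 ≃ₜ S4)) : Prop :=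
  IsDiscrete ((fun g : S4 ≃ₜ S4 => (⟨g, g.continuous⟩ : C(S4, S4))) '' (G : Set (S4 ≃ₜ S4)))

/-- The discontinuity set `Ω(G)`. -/
def discontinuitySet (G : Subgroup (S4 ≃ₜ S4)) : Set S4 :=
  {x | ∃ U ∈ 𝓝 x, {g : S4 ≃ₜ S4 | g ∈ G ∧ (U ∩ g '' U).Nonempty}.Finite}

/-- Kleinian groups: discrete groups of Möbius transformations with nonempty discontinuity set. -/
structure IsKleinian (G : Subgroup (S4 ≃ₜ S4)) : Prop where
  mobius : ∀ g ∈ G, IsMobius g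
  discrete : IsDiscreteGroup G
  nonempty : (discontinuitySet G).Nonempty

/-- Near `x ∈ S` the set `S` is a smooth submanifold with corners of codimension `p` of the
four-sphere: it is cut out by `p` equations and finitely many inequalities whose differentials
at `x` are linearly independent. -/
def IsCornerSubmanifoldAt (p : ℕ) (S : Set S4) (x : S4) : Prop :=
  ∃ (q : ℕ) (f : Fin p → S4 → ℝ) (h : Fin q → S4 → ℝ),
    (∀ i, f i x = 0 ∧ ContMDiffAt 𝓘(ℝ, R4) 𝓘(ℝ, ℝ) ∞ (f i) x) ∧
    (∀ j, h j x = 0 ∧ ContMDiffAt 𝓘(ℝ, R4) 𝓘(ℝ, ℝ) ∞ (h j) x) ∧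
    LinearIndependent ℝ (Sum.elim
      (fun i => scalarDeriv (f i) x) (fun j => scalarDeriv (h j) x)) ∧
    ∀ᶠ y in 𝓝 x, y ∈ S ↔ (∀ i, f i y = 0) ∧ ∀ j, 0 ≤ h j y

/-- Fundamental domains of a group acting on the four-sphere. Piecewise smoothness of `D` and
smoothness of its faces are expressed through submanifolds with corners, of codimension zero and
one respectively. -/
structure IsFundamentalDomain (G : Subgroup (S4 ≃ₜ S4)) (D : Set S4) : Prop where
  subset : D ⊆ discontinuitySet G
  subset_closure_interior : D ⊆ closure (interior D)
  piecewise_smooth : ∀ x ∈ closure D ∩ discontinuitySet G,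
    IsCornerSubmanifoldAt 0 (closure D ∩ discontinuitySet G) x
  cover : ⋃ g ∈ G, g '' (closure D ∩ discontinuitySet G) = discontinuitySet G
  disjoint : ∀ g ∈ G, g ≠ 1 → Disjoint (g '' interior D) (interior D)
  /-- The boundary of `D` in `Ω(G)` is divided into smooth faces `F s`; the face `F s` is carried
  to the face `F (σ s)` by the face-pairing transformation `g s`. -/
  faces : ∃ (κ : Type) (F : κ → Set S4) (σ : κ → κ) (g : κ → S4 ≃ₜ S4),
    (⋃ s, F s) = frontier D ∩ discontinuitySet G ∧
    (∀ s, ∀ x ∈ discontinuitySet G, x ∈ closure (F s) → x ∈ F s) ∧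
    (∀ s, ∀ x ∈ F s, IsCornerSubmanifoldAt 1 (F s) x) ∧
    (∀ s t, s ≠ t → F s ⊆ closure (F s \ F t)) ∧
    (∀ x ∈ discontinuitySet G, ∃ U ∈ 𝓝 x, {s | (F s ∩ U).Nonempty}.Finite) ∧
    (∀ s, g s ∈ G ∧ g s ≠ 1 ∧ g s '' F s = F (σ s) ∧ σ (σ s) = s ∧ g (σ s) = (g s)⁻¹)
  locally_finite : ∀ K : Set S4, IsCompact K → K ⊆ discontinuitySet G →
    {g : S4 ≃ₜ S4 | g ∈ G ∧ (g '' D ∩ K).Nonempty}.Finite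

/-! ## Spinning -/

/-- The half-space `ℝ³₊ = {(x₁, x₂, x₃, 0) : x₃ ≥ 0}` of `ℝ⁴`. -/
def halfSpace : Set R4 := {x | 0 ≤ x 2 ∧ x 3 = 0}

/-- Rotation of `ℝ⁴` by the angle `θ` about the plane `{(x₁, x₂, 0, 0)}`. -/
def rotate (θ : ℝ) (x : R4) : R4 :=
  !₂[x 0, x 1, x 2 * Real.cos θ - x 3 * Real.sin θ, x 2 * Real.sin θ + x 3 * Real.cos θ]

/-- The spin of a subset of the half-space. -/
def spin (X : Set R4) : Set R4 :=
  {y | ∃ x ∈ X, ∃ θ ∈ Icc (0 : ℝ) (2 * Real.pi), y = rotate θ x}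

/-- The rotated ball. -/
def RoundBall.rotate (θ : ℝ) (B : RoundBall) : RoundBall :=
  ⟨_root_.rotate θ B.center, B.radius, B.radius_pos⟩

/-- The pairs `(X, Y)` and `(X', Y')`, with `Y ⊆ X` and `Y' ⊆ X'`, are homeomorphic. -/
def PairHomeomorphic (X Y X' Y' : Set R4) : Prop :=
  ∃ h : X ≃ₜ X', ∀ x : X, (x : R4) ∈ Y ↔ (h x : R4) ∈ Y'

/-- The image of the arc parametrized by `[0, 1]`. -/
def arcSet (A : ℝ → R4) : Set R4 := A '' Icc 0 1

/-- Spinnable arcs: smoothly embedded arcs of the half-space with exactly their end-points on the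
boundary plane, and with contact of infinite order with the normal line at each end-point. -/
structure IsSpinnableArc (A : ℝ → R4) : Prop where
  injOn : InjOn A (Icc 0 1)
  smooth : ContDiffOn ℝ ∞ A (Icc 0 1)
  regular : ∀ t ∈ Icc (0 : ℝ) 1, derivWithin A (Icc 0 1) t ≠ 0
  mem_halfSpace : ∀ t ∈ Icc (0 : ℝ) 1, A t ∈ halfSpace
  interior : ∀ t ∈ Ioo (0 : ℝ) 1, 0 < A t 2
  endpoint_zero : A 0 2 = 0
  endpoint_one : A 1 2 = 0
  contact_zero : ∀ j : Fin 4, j = 0 ∨ j = 1 → ∀ n : ℕ,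
    (fun t => A t j - A 0 j) =O[𝓝[Icc 0 1] 0] fun t => t ^ n
  contact_one : ∀ j : Fin 4, j = 0 ∨ j = 1 → ∀ n : ℕ,
    (fun t => A t j - A 1 j) =O[𝓝[Icc 0 1] 1] fun t => (1 - t) ^ n

/-- The arc is knotted: closing it up by the segment of the boundary plane joining its end-points
gives a knot of three-space which no homeomorphism of three-space carries to a round circle. -/
def IsKnottedArc (A : ℝ → R4) : Prop :=
  ¬ PairHomeomorphic {x | x 3 = 0} (arcSet A ∪ segment ℝ (A 0) (A 1))
    {x | x 3 = 0} {x | x 0 ^ 2 + x 1 ^ 2 = 1 ∧ x 2 = 0 ∧ x 3 = 0}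

/-- `(X, Y)` is homeomorphic to the pair formed by a three-ball and a diameter. -/
def IsUnknottedArcPair (X Y : Set R4) : Prop :=
  PairHomeomorphic X Y {x | x ∈ Metric.closedBall 0 1 ∧ x 3 = 0}
    {x | x ∈ Metric.closedBall 0 1 ∧ x 1 = 0 ∧ x 2 = 0 ∧ x 3 = 0}

/-- `(X, Y)` is homeomorphic to the pair formed by a four-ball and a flat equatorial disk. -/
def IsUnknottedDiskPair (X Y : Set R4) : Prop :=
  PairHomeomorphic X Y (Metric.closedBall 0 1)
    {x | x ∈ Metric.closedBall 0 1 ∧ x 2 = 0 ∧ x 3 = 0}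

/-! ## Pearl-necklaces -/

/-- A semi-pearl solid necklace of `n + 1` balls subordinate to the arc `A`. -/
structure IsSemiNecklace (A : ℝ → R4) {n : ℕ} (B : Fin (n + 1) → RoundBall) : Prop where
  center_mem : ∀ k, (B k).center ∈ halfSpace
  center_first : (B 0).center = A 0
  center_last : (B (Fin.last n)).center = A 1
  cover : arcSet A ⊆ ⋃ k, (B k).solid
  orthogonal : ∀ k : Fin n, (B k.castSucc).Orthogonal (B k.succ)
  disjoint : ∀ j k : Fin (n + 1), (j : ℕ) + 1 < k → Disjoint (B j).solid (B k).solid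
  unknotted : ∀ k, IsUnknottedArcPair ((B k).solid ∩ halfSpace)
    (closure (arcSet A ∩ (B k).inner))

/-- The index set of a pearl-necklace whose arc carries `m + 1` intermediate pearls: the pearls on
the six meridians (of latitude `k` and longitude `i`), the two pearls at the poles, and the pearls
set at the common points of four neighbouring meridian pearls. -/
inductive PearlIndex (m : ℕ) : Type
  | meridian (k : Fin (m + 1)) (i : ZMod 6)
  | pole (j : Fin 2)
  | joint (k : Fin m) (i : ZMod 6)

/-- The angle `2πi/6` of the `i`-th meridian. -/
def meridianAngle (i : ZMod 6) : ℝ := 2 * Real.pi * (i.val : ℝ) / 6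

/-- A pearl-necklace subordinate to the spun knot of a knotted spinnable arc. The semi-necklace
consists of the balls `0, …, m + 2`; those numbered `1, …, m + 1` are rotated to the six
meridians. -/
structure PearlNecklace (m : ℕ) where
  arc : ℝ → R4
  spinnable : IsSpinnableArc arc
  knotted : IsKnottedArc arc
  semi : Fin (m + 3) → RoundBall
  isSemiNecklace : IsSemiNecklace arc semi
  /-- All the pearls of the necklace. -/
  pearl : PearlIndex m → RoundBall
  meridian_eq : ∀ k i,
    pearl (.meridian k i) = (semi k.succ.castSucc).rotate (meridianAngle i)
  meridian_orthogonal : ∀ k i,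
    (pearl (.meridian k i)).Orthogonal (pearl (.meridian k (i + 1)))
  pole_zero_center : (pearl (.pole 0)).center = arc 0
  pole_one_center : (pearl (.pole 1)).center = arc 1
  pole_zero_orthogonal : ∀ i, (pearl (.pole 0)).Orthogonal (pearl (.meridian 0 i))
  pole_one_orthogonal : ∀ i, (pearl (.pole 1)).Orthogonal (pearl (.meridian (Fin.last m) i))
  pole_zero_inter : ∀ i, ((pearl (.pole 0)).sphere ∩
    ((pearl (.meridian 0 i)).sphere ∩ (pearl (.meridian 0 (i + 1))).sphere)).Nonempty
  pole_one_inter : ∀ i, ((pearl (.pole 1)).sphere ∩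
    ((pearl (.meridian (Fin.last m) i)).sphere ∩
      (pearl (.meridian (Fin.last m) (i + 1))).sphere)).Nonempty
  /-- The pearl set at the common point of the four pearls of latitudes `k`, `k + 1` and longitudes
  `i`, `i + 1` is orthogonal to these four pearls (this forces it to pass through that point). -/
  joint_orthogonal : ∀ (k : Fin m) (i : ZMod 6), ∀ r ∈ ({k.castSucc, k.succ} : Set (Fin (m + 1))),
    ∀ s ∈ ({i, i + 1} : Set (ZMod 6)), (pearl (.joint k i)).Orthogonal (pearl (.meridian r s))
  joint_disjoint_meridian : ∀ (k : Fin m) (i : ZMod 6) (r : Fin (m + 1)) (s : ZMod 6),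
    ¬ (r ∈ ({k.castSucc, k.succ} : Set (Fin (m + 1))) ∧ s ∈ ({i, i + 1} : Set (ZMod 6))) →
    Disjoint (pearl (.joint k i)).solid (pearl (.meridian r s)).solid
  joint_disjoint_pole : ∀ k i j, Disjoint (pearl (.joint k i)).solid (pearl (.pole j)).solid
  joint_disjoint_joint : ∀ k i k' i', (k, i) ≠ (k', i') →
    Disjoint (pearl (.joint k i)).solid (pearl (.joint k' i')).solid
  unknotted_disk : ∀ k i, IsUnknottedDiskPair (pearl (.meridian k i)).solid
    ((pearl (.meridian k i)).solid ∩ spin (arcSet arc))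

namespace PearlNecklace

variable {m : ℕ}

/-- The filling: the union of all the solid pearls, as a subset of the four-sphere. -/
def filling (N : PearlNecklace m) : Set S4 :=
  ⋃ j, ((↑) : R4 → S4) '' (N.pearl j).solid

/-- The group generated by the reflections in the pearls. -/
def group (N : PearlNecklace m) : Subgroup (S4 ≃ₜ S4) :=
  Subgroup.closure (range fun j => (N.pearl j).reflection)

/-- The relators `I_j²`, for all pearls, and `(I_i I_j)²`, for all pairs of orthogonal pearls. -/
def relators (N : PearlNecklace m) : Set (FreeGroup (PearlIndex m)) :=
  {w | ∃ j, w = FreeGroup.of j ^ 2} ∪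
    {w | ∃ i j, (N.pearl i).Orthogonal (N.pearl j) ∧
      w = (FreeGroup.of i * FreeGroup.of j) ^ 2}

end PearlNecklace

end

/-!
The proof uses the pearls only through one property: two different pearls are either orthogonal or
bound balls with disjoint interiors (`IsRightAngled`, `PearlNecklace.isRightAngled_pearl`). For the
meridian pearls this is the law of cosines: orthogonality of neighbouring copies of a ball forces
the height of its centre to be `√2` times its radius, so that diagonal neighbours are tangent, and
all other pairs are orthogonal or further apart. Everything else holds for the group generated by
the reflections in any finite family of this kind.

*Presentation.* Let `W` be the right-angled Coxeter group of the family. A reduced word of `W`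
maps the complement `D` of the closed balls into the open ball of its first letter
(`CoxeterQuotient.IsReduced.mem_cap`): either the ball of the second letter lies outside that of the
first, or the two letters commute and can be exchanged. Hence `W` acts faithfully, the translates of
`D` are disjoint, and the group is discrete.

*Covering.* Inversions preserve the form `chordal`, the squared distance extended to `∞`, up to a
product of conformal factors. Only finitely many elements have conformal factor at `∞` above a given
bound, since the orbit of `∞` is bounded and its corresponding points are separated
(`finite_factor_infty_ge`). If the orbit of a point `x` never leaves the open balls, then the
conformal factors at `x` have no maximum, as an inversion expands inside its ball. So infinitely
many elements `g` have factor at least `1` at `x`, and the points `g⁻¹ ∞` converge to `x`, which is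
thus not a point of discontinuity (`exists_apply_mem_closedExterior`).

*Local structure.* A common point of two tangent pearls has an infinite stabilizer. At every other
point outside the open balls the pearls through the point are pairwise orthogonal, and a
neighbourhood is covered by the translates of the closure of `D` under finitely many commuting
reflections (`IsRegularPoint.exists_nhds`). So these points form the closure of `D` in the
discontinuity set. The radii at such a point are orthogonal, which gives the corner structure of the
domain and of its faces; each face is paired with itself by the reflection in its pearl.
-/

noncomputable section

section

/-! ### Reflections and caps -/

namespace RoundBall

/-- The open ball as a subset of the four-sphere. -/
def cap (B : RoundBall) : Set S4 := ((↑) : R4 → S4) '' B.inner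

/-- The closed ball as a subset of the four-sphere. -/
def closedCap (B : RoundBall) : Set S4 := ((↑) : R4 → S4) '' B.solid

/-- The boundary sphere as a subset of the four-sphere. -/
def rim (B : RoundBall) : Set S4 := ((↑) : R4 → S4) '' B.sphere

variable {B B' : RoundBall}

lemma infty_notMem_closedCap : OnePoint.infty ∉ B.closedCap := by
  rintro ⟨y, -, h⟩
  exact OnePoint.coe_ne_infty y h

lemma coe_mem_cap {y : R4} : (y : S4) ∈ B.cap ↔ dist y B.center < B.radius := by
  simp [cap, inner]

lemma coe_mem_closedCap {y : R4} : (y : S4) ∈ B.closedCap ↔ dist y B.center ≤ B.radius := by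
  simp [closedCap, solid]

lemma coe_mem_rim {y : R4} : (y : S4) ∈ B.rim ↔ dist y B.center = B.radius := by
  simp [rim, sphere, dist_eq_norm]

lemma cap_subset_closedCap : B.cap ⊆ B.closedCap := image_mono Metric.ball_subset_closedBall

lemma rim_subset_closedCap : B.rim ⊆ B.closedCap := image_mono Metric.sphere_subset_closedBall

lemma closedCap_diff_cap : B.closedCap \ B.cap = B.rim := by
  rw [closedCap, cap, ← image_sdiff OnePoint.coe_injective, solid, inner,
    Metric.closedBall_sdiff_ball, rim, sphere]

lemma isOpen_cap : IsOpen B.cap :=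
  OnePoint.isOpenEmbedding_coe.isOpenMap _ Metric.isOpen_ball

lemma isClosed_closedCap : IsClosed B.closedCap :=
  ((isCompact_closedBall _ _).image OnePoint.continuous_coe).isClosed

lemma isClosed_rim : IsClosed B.rim :=
  ((isCompact_sphere _ _).image OnePoint.continuous_coe).isClosed

lemma reflection_apply (x : S4) : B.reflection x = B.reflectionFun x := rfl

lemma reflection_reflection (x : S4) : B.reflection (B.reflection x) = x :=
  B.reflectionFun_involutive x

lemma reflection_mul_self : B.reflection * B.reflection = 1 :=
  Homeomorph.ext B.reflectionFun_involutive

lemma reflection_inv : B.reflection⁻¹ = B.reflection :=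
  inv_eq_of_mul_eq_one_left reflection_mul_self

lemma reflection_of_mem_rim {x : S4} (hx : x ∈ B.rim) : B.reflection x = x := by
  obtain ⟨y, hy, rfl⟩ := hx
  have hne : y ≠ B.center := by
    rintro rfl
    have h : dist B.center B.center = B.radius := hy
    rw [dist_self] at h
    exact B.radius_pos.ne h
  rw [reflection_apply, reflectionFun_coe B hne, EuclideanGeometry.inversion_of_mem_sphere hy]

lemma reflection_mem_cap {x : S4} (hx : x ∉ B.closedCap) : B.reflection x ∈ B.cap := by
  induction x using OnePoint.rec with
  | infty =>
    rw [reflection_apply, reflectionFun_infty, coe_mem_cap, dist_self]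
    exact B.radius_pos
  | coe y =>
    rw [coe_mem_closedCap, not_le] at hx
    have h0 := B.radius_pos
    have hne : y ≠ B.center := by
      rintro rfl
      rw [dist_self] at hx
      linarith
    rw [reflection_apply, reflectionFun_coe B hne, coe_mem_cap,
      EuclideanGeometry.dist_inversion_center, div_lt_iff₀ (by linarith)]
    nlinarith

lemma reflection_notMem_closedCap {x : S4} (hx : x ∈ B.cap) : B.reflection x ∉ B.closedCap := by
  obtain ⟨y, hy, rfl⟩ := hx
  have hy : dist y B.center < B.radius := hy
  by_cases hne : y = B.center
  · rw [hne, reflection_apply, reflectionFun_center]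
    exact infty_notMem_closedCap
  · have h0 := B.radius_pos
    have h1 := dist_pos.2 hne
    rw [reflection_apply, reflectionFun_coe B hne, coe_mem_closedCap, not_le,
      EuclideanGeometry.dist_inversion_center, lt_div_iff₀ h1]
    nlinarith

/-- A reflection maps every ball orthogonal to its sphere into itself. -/
lemma Orthogonal.reflection_mem_cap (h : B.Orthogonal B') {x : S4} (hx : x ∈ B'.cap) :
    B.reflection x ∈ B'.cap := by
  obtain ⟨y, hy, rfl⟩ := hx
  have hy : dist y B'.center < B'.radius := hy
  have h : dist B.center B'.center ^ 2 = B.radius ^ 2 + B'.radius ^ 2 := h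
  have hr := B.radius_pos
  have hr' := B'.radius_pos
  have hne : y ≠ B.center := by
    rintro rfl
    nlinarith [dist_nonneg (x := B.center) (y := B'.center)]
  rw [reflection_apply, reflectionFun_coe B hne, coe_mem_cap]
  obtain ⟨u, rfl⟩ : ∃ u, y = B.center + u := ⟨y - B.center, by abel⟩
  obtain ⟨d, hd⟩ : ∃ d, B'.center = B.center + d := ⟨B'.center - B.center, by abel⟩
  have hu : u ≠ 0 := by simpa using hne
  have hu0 : 0 < ‖u‖ := norm_pos_iff.2 hu
  rw [hd] at h hy ⊢
  rw [dist_eq_norm] at h hy ⊢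
  have e1 : B.center - (B.center + d) = -d := by abel
  have e2 : B.center + u - (B.center + d) = u - d := by abel
  rw [e1, norm_neg] at h
  rw [e2] at hy
  rw [EuclideanGeometry.inversion]
  simp only [dist_eq_norm, add_sub_cancel_left, vsub_eq_sub, vadd_eq_add]
  have e3 : (B.radius / ‖u‖) ^ 2 • u + B.center - (B.center + d)
      = (B.radius / ‖u‖) ^ 2 • u - d := by abel
  rw [e3]
  refine lt_of_pow_lt_pow_left₀ 2 hr'.le ?_
  have hy2 : ‖u - d‖ ^ 2 < B'.radius ^ 2 := by
    gcongr
  rw [@norm_sub_sq_real] at hy2 ⊢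
  rw [norm_smul, real_inner_smul_left, h, Real.norm_of_nonneg (by positivity)]
  rw [h] at hy2
  set k := (B.radius / ‖u‖) ^ 2 with hk
  have hkpos : 0 < k := by positivity
  have hku : k * ‖u‖ ^ 2 = B.radius ^ 2 := by
    rw [hk]; field_simp
  have : (k * ‖u‖) ^ 2 = k * B.radius ^ 2 := by rw [← hku]; ring
  rw [this, ← hku]
  rw [← hku] at hy2
  nlinarith

lemma Orthogonal.symm (h : B.Orthogonal B') : B'.Orthogonal B := by
  rw [Orthogonal, dist_comm, add_comm]
  exact h

lemma disjoint_cap_closedCap (h : B.radius + B'.radius ≤ dist B.center B'.center) :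
    Disjoint B.closedCap B'.cap :=
  (disjoint_image_iff OnePoint.coe_injective).2 (Metric.closedBall_disjoint_ball h)

lemma reflection_ne_one : B.reflection ≠ 1 := by
  intro h
  have : B.reflection OnePoint.infty = OnePoint.infty := by rw [h]; rfl
  exact OnePoint.coe_ne_infty _ this

variable (B B') in
/-- The balls are orthogonal or have disjoint interiors. -/
def OrthogonalOrSeparate : Prop :=
  B.Orthogonal B' ∨ B.radius + B'.radius ≤ dist B.center B'.center

lemma OrthogonalOrSeparate.symm (h : B.OrthogonalOrSeparate B') : B'.OrthogonalOrSeparate B :=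
  h.imp Orthogonal.symm fun h => by rwa [add_comm, dist_comm]

end RoundBall

/-! ### The light-cone model -/

/-- The null vector representing a point of the four-sphere in the light-cone model. -/
def lightVector (x : S4) : R4 × ℝ × ℝ := x.elim (0, 1, 0) fun y => (y, ‖y‖ ^ 2, 1)

lemma eq_of_lightVector_smul {x y : S4} {a b : ℝ} (ha : a ≠ 0) (hb : b ≠ 0)
    (h : a • lightVector x = b • lightVector y) : x = y := by
  have h2 := congrArg (fun w => w.2.2) h
  induction x using OnePoint.rec with
  | infty =>
    induction y using OnePoint.rec with
    | infty => rfl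
    | coe y => exact absurd (by simpa [lightVector] using h2.symm) hb
  | coe x =>
    induction y using OnePoint.rec with
    | infty => exact absurd (by simpa [lightVector] using h2) ha
    | coe y =>
      have h1 := congrArg (fun w => w.1) h
      simp only [lightVector, OnePoint.elim_some, Prod.smul_mk, smul_eq_mul, mul_one] at h1 h2
      subst h2
      rw [smul_right_injective R4 ha h1]

namespace RoundBall

/-- The linear map induced by an inversion on the light-cone model, up to a scalar. -/
def lightMap (B : RoundBall) (w : R4 × ℝ × ℝ) : R4 × ℝ × ℝ :=
  let q := w.2.1 - 2 * Inner.inner ℝ w.1 B.center + ‖B.center‖ ^ 2 * w.2.2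
  (q • B.center + B.radius ^ 2 • (w.1 - w.2.2 • B.center),
    q * ‖B.center‖ ^ 2 + 2 * B.radius ^ 2 * (Inner.inner ℝ w.1 B.center - w.2.2 * ‖B.center‖ ^ 2)
      + B.radius ^ 4 * w.2.2, q)

lemma lightMap_smul (B : RoundBall) (k : ℝ) (w : R4 × ℝ × ℝ) :
    B.lightMap (k • w) = k • B.lightMap w := by
  simp only [lightMap, Prod.smul_fst, Prod.smul_snd, real_inner_smul_left, smul_eq_mul, Prod.smul_mk,
    Prod.mk.injEq]
  refine ⟨?_, by ring, by ring⟩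
  module

lemma exists_lightMap_lightVector (B : RoundBall) (x : S4) :
    ∃ k : ℝ, k ≠ 0 ∧ B.lightMap (lightVector x) = k • lightVector (B.reflection x) := by
  have hr := B.radius_pos
  rw [reflection_apply]
  induction x using OnePoint.rec with
  | infty =>
    refine ⟨1, one_ne_zero, ?_⟩
    simp [reflectionFun_infty, lightVector, lightMap]
  | coe y =>
    by_cases hy : y = B.center
    · subst hy
      refine ⟨B.radius ^ 4, by positivity, ?_⟩
      rw [reflectionFun_center]
      simp only [lightVector, lightMap, OnePoint.elim_some, OnePoint.elim_infty,
        real_inner_self_eq_norm_sq, Prod.smul_mk, Prod.mk.injEq, smul_eq_mul]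
      refine ⟨?_, by ring, by ring⟩
      module
    · have hd : 0 < dist y B.center := dist_pos.2 hy
      rw [reflectionFun_coe B hy]
      refine ⟨dist y B.center ^ 2, by positivity, ?_⟩
      have hq : dist y B.center ^ 2 = ‖y‖ ^ 2 - 2 * Inner.inner ℝ y B.center + ‖B.center‖ ^ 2 := by
        rw [dist_eq_norm, @norm_sub_sq_real]
      have hv : EuclideanGeometry.inversion B.center B.radius y =
          (B.radius ^ 2 / dist y B.center ^ 2) • (y - B.center) + B.center := by
        rw [EuclideanGeometry.inversion, div_pow]; rfl
      have h1 : dist y B.center ^ 2 • EuclideanGeometry.inversion B.center B.radius y =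
          dist y B.center ^ 2 • B.center + B.radius ^ 2 • (y - B.center) := by
        rw [hv, smul_add, smul_smul, mul_div_cancel₀ _ (by positivity), add_comm]
      have h2 : ‖EuclideanGeometry.inversion B.center B.radius y‖ ^ 2 =
          (B.radius ^ 2 / dist y B.center ^ 2) ^ 2 * dist y B.center ^ 2 + 2 *
          (B.radius ^ 2 / dist y B.center ^ 2) * (Inner.inner ℝ y B.center - ‖B.center‖ ^ 2)
            + ‖B.center‖ ^ 2 := by
        rw [hv, @norm_add_sq_real, norm_smul, real_inner_smul_left, inner_sub_left,
          real_inner_self_eq_norm_sq, mul_pow, ← dist_eq_norm, Real.norm_eq_abs, sq_abs]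
        ring
      simp only [lightVector, lightMap, OnePoint.elim_some, mul_one, one_smul, one_mul,
        Prod.smul_mk, smul_eq_mul, Prod.mk.injEq]
      rw [h1, h2, ← hq]
      refine ⟨rfl, ?_, rfl⟩
      field_simp
      ring

/-- Reflections in orthogonal spheres commute. -/
lemma Orthogonal.reflection_comm {B B' : RoundBall} (h : B.Orthogonal B') :
    B.reflection * B'.reflection = B'.reflection * B.reflection := by
  have key : ∀ w, B.lightMap (B'.lightMap w) = B'.lightMap (B.lightMap w) := by
    intro ⟨v, s, t⟩
    -- Orthogonality determines the inner product of the centres.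
    have h1 : Inner.inner ℝ B.center B'.center =
        (‖B.center‖ ^ 2 + ‖B'.center‖ ^ 2 - B.radius ^ 2 - B'.radius ^ 2) / 2 := by
      rw [Orthogonal, dist_eq_norm, @norm_sub_sq_real] at h
      linarith
    have h2 : Inner.inner ℝ B'.center B.center =
        (‖B.center‖ ^ 2 + ‖B'.center‖ ^ 2 - B.radius ^ 2 - B'.radius ^ 2) / 2 := by
      rw [real_inner_comm, h1]
    simp only [lightMap, inner_add_left, inner_sub_left, real_inner_smul_left, h1, h2, Prod.mk.injEq]
    refine ⟨?_, by ring, by ring⟩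
    module
  ext x
  obtain ⟨k1, hk1, e1⟩ := B.exists_lightMap_lightVector x
  obtain ⟨k2, hk2, e2⟩ := B'.exists_lightMap_lightVector x
  obtain ⟨k3, hk3, e3⟩ := B.exists_lightMap_lightVector (B'.reflection x)
  obtain ⟨k4, hk4, e4⟩ := B'.exists_lightMap_lightVector (B.reflection x)
  have h1 := key (lightVector x)
  rw [e1, e2, lightMap_smul, lightMap_smul, e3, e4, smul_smul, smul_smul] at h1
  exact eq_of_lightVector_smul (mul_ne_zero hk2 hk3) (mul_ne_zero hk1 hk4) h1

end RoundBall

/-! ### The chordal form and conformal factors -/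

/-- The squared Euclidean distance, extended to the four-sphere by the value `1` on pairs consisting
of a finite point and `∞`. Up to a constant, it is the pairing of the null vectors representing two
points in the light-cone model, so inversions preserve it up to a product of factors. -/
def chordal (x y : S4) : ℝ :=
  x.elim (y.elim 0 fun _ => 1) fun a => y.elim 1 fun b => dist a b ^ 2

/-- The homeomorphism `g` multiplies the chordal form of two points by the values of `l` at these
points. Where `g` and the point are finite, `l` is the usual conformal factor. -/
def IsConformalFactor (g : S4 ≃ₜ S4) (l : S4 → ℝ) : Prop :=
  (∀ x, 0 < l x) ∧ ∀ x y, chordal (g x) (g y) = l x * l y * chordal x y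

@[simp] lemma chordal_infty_infty : chordal OnePoint.infty OnePoint.infty = 0 := rfl
@[simp] lemma chordal_infty_coe (b : R4) : chordal OnePoint.infty (b : S4) = 1 := rfl
@[simp] lemma chordal_coe_infty (a : R4) : chordal (a : S4) OnePoint.infty = 1 := rfl
@[simp] lemma chordal_coe_coe (a b : R4) : chordal (a : S4) (b : S4) = dist a b ^ 2 := rfl

lemma chordal_comm (x y : S4) : chordal x y = chordal y x := by
  induction x using OnePoint.rec <;> induction y using OnePoint.rec <;> simp [dist_comm]

lemma chordal_pos {x y : S4} (h : x ≠ y) : 0 < chordal x y := by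
  induction x using OnePoint.rec with
  | infty =>
    induction y using OnePoint.rec with
    | infty => exact absurd rfl h
    | coe b => simp
  | coe a =>
    induction y using OnePoint.rec with
    | infty => simp
    | coe b =>
      have : 0 < dist a b := dist_pos.2 fun hab => h (by rw [hab])
      simpa using by positivity

@[simp] lemma chordal_self (x : S4) : chordal x x = 0 := by
  induction x using OnePoint.rec <;> simp

open Classical in
/-- The conformal factor of an inversion. -/
def RoundBall.factor (B : RoundBall) (x : S4) : ℝ :=
  x.elim (B.radius ^ 2) fun y =>
    if y = B.center then (B.radius ^ 2)⁻¹ else B.radius ^ 2 / dist y B.center ^ 2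

namespace RoundBall

lemma isConformalFactor (B : RoundBall) : IsConformalFactor B.reflection B.factor := by
  have hr := B.radius_pos
  have hi : B.reflection OnePoint.infty = (B.center : S4) := rfl
  have hc : B.reflection (B.center : S4) = OnePoint.infty := B.reflectionFun_center
  have hy : ∀ y : R4, y ≠ B.center → B.reflection (y : S4) =
    ((EuclideanGeometry.inversion B.center B.radius y : R4) : S4) := fun y => B.reflectionFun_coe
  have fi : B.factor OnePoint.infty = B.radius ^ 2 := rfl
  have fc : B.factor (B.center : S4) = (B.radius ^ 2)⁻¹ := by simp [factor]
  have fy : ∀ y : R4, y ≠ B.center → B.factor (y : S4) = B.radius ^ 2 / dist y B.center ^ 2 :=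
    fun y h => by simp [factor, h]
  have hd : ∀ y : R4, y ≠ B.center → 0 < dist y B.center := fun y h => dist_pos.2 h
  have cases : ∀ x : S4, x = OnePoint.infty ∨ x = (B.center : S4) ∨
      ∃ y : R4, y ≠ B.center ∧ x = (y : S4) := by
    intro x
    induction x using OnePoint.rec with
    | infty => exact .inl rfl
    | coe y =>
      by_cases h : y = B.center
      · exact .inr (.inl (by rw [h]))
      · exact .inr (.inr ⟨y, h, rfl⟩)
  constructor
  · intro x
    obtain rfl | rfl | ⟨y, h, rfl⟩ := cases x
    · rw [fi]; positivity
    · rw [fc]; positivity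
    · have := hd y h
      rw [fy y h]; positivity
  -- By symmetry it suffices to treat one order of the two points.
  · have half : ∀ x y : S4, (x = OnePoint.infty ∨ (x = (B.center : S4) ∧ y ≠ OnePoint.infty) ∨
        (∃ a : R4, a ≠ B.center ∧ x = (a : S4)) ∧
          ∃ a : R4, a ≠ B.center ∧ y = (a : S4)) →
        chordal (B.reflection x) (B.reflection y) = B.factor x * B.factor y * chordal x y := by
      rintro x y (rfl | ⟨rfl, hyi⟩ | ⟨⟨a, ha, rfl⟩, ⟨b, hb, rfl⟩⟩)
      · obtain rfl | rfl | ⟨b, hb, rfl⟩ := cases y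
        · simp [hi]
        · rw [hi, hc, fi, fc, chordal_coe_infty, chordal_infty_coe]
          field_simp
        · have := hd b hb
          rw [hi, hy b hb, fi, fy b hb, chordal_coe_coe, chordal_infty_coe, dist_comm,
            EuclideanGeometry.dist_inversion_center]
          field_simp
      · obtain rfl | rfl | ⟨b, hb, rfl⟩ := cases y
        · exact absurd rfl hyi
        · simp
        · have := hd b hb
          rw [hc, hy b hb, fc, fy b hb, chordal_coe_coe, chordal_infty_coe, dist_comm B.center b]
          field_simp
      · have := hd a ha
        have := hd b hb
        rw [hy a ha, hy b hb, fy a ha, fy b hb, chordal_coe_coe, chordal_coe_coe,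
          EuclideanGeometry.dist_inversion_inversion ha hb]
        field_simp
    intro x y
    by_cases h : x = OnePoint.infty ∨ (x = (B.center : S4) ∧ y ≠ OnePoint.infty) ∨
        (∃ a : R4, a ≠ B.center ∧ x = (a : S4)) ∧ ∃ a : R4, a ≠ B.center ∧ y = (a : S4)
    · exact half x y h
    · rw [chordal_comm, half y x, chordal_comm y x]
      · ring
      · obtain rfl | rfl | hx := cases x <;> obtain rfl | rfl | hy := cases y <;> simp_all

/-- Inversions expand inside their ball. -/
lemma one_lt_factor {B : RoundBall} {x : S4} (hx : x ∈ B.cap) (hc : x ≠ (B.center : S4)) :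
    1 < B.factor x := by
  obtain ⟨y, hy, rfl⟩ := hx
  have hy : dist y B.center < B.radius := hy
  have hne : y ≠ B.center := fun h => hc (by rw [h])
  have := dist_pos.2 hne
  have e : B.factor (y : S4) = B.radius ^ 2 / dist y B.center ^ 2 := by simp [factor, hne]
  rw [e, one_lt_div (by positivity)]
  gcongr

end RoundBall

namespace IsConformalFactor

variable {g h : S4 ≃ₜ S4} {l l' : S4 → ℝ}

lemma one : IsConformalFactor 1 fun _ => 1 :=
  ⟨fun _ => one_pos, fun x y => by simp⟩

lemma mul (hg : IsConformalFactor g l) (hh : IsConformalFactor h l') :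
    IsConformalFactor (g * h) fun x => l (h x) * l' x := by
  refine ⟨fun x => mul_pos (hg.1 _) (hh.1 _), fun x y => ?_⟩
  have : chordal ((g * h) x) ((g * h) y) = chordal (g (h x)) (g (h y)) := rfl
  rw [this, hg.2, hh.2]
  ring

lemma inv (hg : IsConformalFactor g l) : IsConformalFactor g⁻¹ fun x => (l (g⁻¹ x))⁻¹ := by
  refine ⟨fun x => inv_pos.2 (hg.1 _), fun x y => ?_⟩
  have h1 := hg.2 (g⁻¹ x) (g⁻¹ y)
  have e : ∀ x, g (g⁻¹ x) = x := g.apply_symm_apply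
  rw [e, e] at h1
  have := hg.1 (g⁻¹ x)
  have := hg.1 (g⁻¹ y)
  rw [h1]
  field_simp

/-- The conformal factor is determined by the map, because its products over pairs of different
points are. -/
lemma unique (hl : IsConformalFactor g l) (hl' : IsConformalFactor g l') : l = l' := by
  have key : ∀ x y, x ≠ y → l x * l y = l' x * l' y := fun x y hxy =>
    mul_right_cancel₀ (chordal_pos hxy).ne' ((hl.2 x y).symm.trans (hl'.2 x y))
  funext x
  obtain ⟨y, hy⟩ : ∃ y, y ∉ ({x} : Set S4) :=
    ((Set.finite_singleton x).infinite_compl).nonempty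
  obtain ⟨z, hz⟩ : ∃ z, z ∉ ({x, y} : Set S4) :=
    ((Set.toFinite ({x, y} : Set S4)).infinite_compl).nonempty
  simp only [mem_insert_iff, mem_singleton_iff, not_or] at hy hz
  have h1 := key x y (Ne.symm hy)
  have h2 := key x z (Ne.symm hz.1)
  have h3 := key y z (Ne.symm hz.2)
  have p1 := hl.1 x; have p2 := hl.1 y; have p3 := hl.1 z
  have q1 := hl'.1 x; have q2 := hl'.1 y; have q3 := hl'.1 z
  have h4 : l x ^ 2 * (l y * l z) = l' x ^ 2 * (l y * l z) := by
    calc l x ^ 2 * (l y * l z) = (l x * l y) * (l x * l z) := by ring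
      _ = (l' x * l' y) * (l' x * l' z) := by rw [h1, h2]
      _ = l' x ^ 2 * (l' y * l' z) := by ring
      _ = _ := by rw [h3]
  have h5 := mul_right_cancel₀ (by positivity) h4
  exact (pow_left_inj₀ p1.le q1.le two_ne_zero).1 h5

end IsConformalFactor

end

section

/-! ### Right-angled families of balls and their reflection groups -/

/-- Any two different balls of the family are orthogonal or have disjoint interiors. -/
def IsRightAngled {ι : Type} (p : ι → RoundBall) : Prop :=
  ∀ i j, i ≠ j → (p i).OrthogonalOrSeparate (p j)

variable {ι : Type} (p : ι → RoundBall)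

/-- The group generated by the reflections of a family. -/
def reflectionGroup : Subgroup (S4 ≃ₜ S4) :=
  Subgroup.closure (range fun j => (p j).reflection)

/-- The exterior of a family: the complement of the closed balls. -/
def exterior : Set S4 := (⋃ j, (p j).closedCap)ᶜ

/-- The complement of the open balls of a family. -/
def closedExterior : Set S4 := (⋃ j, (p j).cap)ᶜ

/-- The relators of the right-angled Coxeter group attached to a family. -/
def coxeterRelators : Set (FreeGroup ι) :=
  {w | ∃ j, w = FreeGroup.of j ^ 2} ∪
    {w | ∃ i j, (p i).Orthogonal (p j) ∧ w = (FreeGroup.of i * FreeGroup.of j) ^ 2}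

variable {p}

lemma mem_exterior {x : S4} : x ∈ exterior p ↔ ∀ j, x ∉ (p j).closedCap := by
  simp [exterior]

lemma mem_closedExterior {x : S4} : x ∈ closedExterior p ↔ ∀ j, x ∉ (p j).cap := by
  simp [closedExterior]

lemma infty_mem_exterior : OnePoint.infty ∈ exterior p :=
  mem_exterior.2 fun _ => RoundBall.infty_notMem_closedCap

lemma exterior_subset_closedExterior : exterior p ⊆ closedExterior p := fun _ hx =>
  mem_closedExterior.2 fun j h => mem_exterior.1 hx j (RoundBall.cap_subset_closedCap h)

lemma isOpen_exterior [Finite ι] : IsOpen (exterior p) :=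
  (isClosed_iUnion_of_finite fun _ => RoundBall.isClosed_closedCap).isOpen_compl

lemma isClosed_closedExterior : IsClosed (closedExterior p) :=
  (isOpen_iUnion fun _ => RoundBall.isOpen_cap).isClosed_compl

lemma reflection_mem_reflectionGroup (j : ι) : (p j).reflection ∈ reflectionGroup p :=
  Subgroup.subset_closure ⟨j, rfl⟩

lemma reflection_relators (w : FreeGroup ι) (hw : w ∈ coxeterRelators p) :
    FreeGroup.lift (fun j => (p j).reflection) w = 1 := by
  obtain ⟨j, rfl⟩ | ⟨i, j, hij, rfl⟩ := hw
  · rw [map_pow, FreeGroup.lift_apply_of, pow_two, RoundBall.reflection_mul_self]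
  · rw [map_pow, map_mul, FreeGroup.lift_apply_of, FreeGroup.lift_apply_of, pow_two]
    nth_rewrite 1 [hij.reflection_comm]
    rw [mul_assoc, ← mul_assoc (p i).reflection, RoundBall.reflection_mul_self, one_mul,
      RoundBall.reflection_mul_self]

variable (p) in
/-- The right-angled Coxeter group attached to a family. -/
abbrev CoxeterQuotient : Type := PresentedGroup (coxeterRelators p)

namespace CoxeterQuotient

variable (p) in
/-- The representation of the Coxeter group by reflections. -/
def toHomeomorph : CoxeterQuotient p →* (S4 ≃ₜ S4) :=
  PresentedGroup.toGroup reflection_relators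

variable (p) in
/-- The element represented by a word. -/
def word (l : List ι) : CoxeterQuotient p := (l.map fun j => PresentedGroup.of j).prod

lemma toHomeomorph_of (j : ι) :
    toHomeomorph p (PresentedGroup.of j) = (p j).reflection :=
  PresentedGroup.toGroup.of reflection_relators

lemma word_nil : word p [] = 1 := rfl

lemma word_cons (j : ι) (l : List ι) : word p (j :: l) = PresentedGroup.of j * word p l := by
  simp [word]

lemma word_append (l l' : List ι) : word p (l ++ l') = word p l * word p l' := by
  simp [word]

lemma of_mul_of (j : ι) :
    (PresentedGroup.of j : CoxeterQuotient p) * PresentedGroup.of j = 1 := by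
  have : (PresentedGroup.mk (coxeterRelators p)) (FreeGroup.of j ^ 2) = 1 :=
    PresentedGroup.one_of_mem (.inl ⟨j, rfl⟩)
  rwa [map_pow, pow_two] at this

lemma of_inv (j : ι) :
    (PresentedGroup.of j : CoxeterQuotient p)⁻¹ = PresentedGroup.of j :=
  inv_eq_of_mul_eq_one_left (of_mul_of j)

lemma of_comm {i j : ι} (h : (p i).Orthogonal (p j)) :
    (PresentedGroup.of i : CoxeterQuotient p) * PresentedGroup.of j =
      PresentedGroup.of j * PresentedGroup.of i := by
  have h1 : (PresentedGroup.mk (coxeterRelators p)) ((FreeGroup.of i * FreeGroup.of j) ^ 2) = 1 :=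
    PresentedGroup.one_of_mem (.inr ⟨i, j, h, rfl⟩)
  rw [map_pow, map_mul, pow_two] at h1
  have h2 := inv_eq_of_mul_eq_one_left h1
  rw [mul_inv_rev] at h2
  change (PresentedGroup.of j : CoxeterQuotient p)⁻¹ * (PresentedGroup.of i)⁻¹ = _ at h2
  rw [of_inv, of_inv] at h2
  exact h2.symm

lemma exists_word (w : CoxeterQuotient p) : ∃ l, word p l = w := by
  have hw : w ∈ Subgroup.closure (range (PresentedGroup.of (rels := coxeterRelators p))) := by
    rw [PresentedGroup.closure_range_of]; trivial
  induction hw using Subgroup.closure_induction with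
  | mem x hx =>
    obtain ⟨j, rfl⟩ := hx
    exact ⟨[j], by simp [word]⟩
  | one => exact ⟨[], rfl⟩
  | mul x y _ _ hx hy =>
    obtain ⟨l, rfl⟩ := hx
    obtain ⟨l', rfl⟩ := hy
    exact ⟨l ++ l', word_append l l'⟩
  | inv x _ hx =>
    obtain ⟨l, rfl⟩ := hx
    refine ⟨l.reverse, ?_⟩
    rw [word, word, List.prod_inv_reverse, List.map_reverse, List.map_map]
    congr 3
    funext j
    exact (of_inv j).symm

variable (p) in
/-- A word is reduced if no shorter word represents the same element. -/
def IsReduced (l : List ι) : Prop := ∀ l', word p l' = word p l → l.length ≤ l'.length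

lemma exists_isReduced (w : CoxeterQuotient p) : ∃ l, word p l = w ∧ IsReduced p l := by
  classical
  have h : ∃ n, ∃ l, word p l = w ∧ l.length = n := by
    obtain ⟨l, hl⟩ := exists_word w
    exact ⟨_, l, hl, rfl⟩
  obtain ⟨l, hl, hn⟩ := Nat.find_spec h
  exact ⟨l, hl, fun l' hl' => hn ▸ Nat.find_min' h ⟨l', hl'.trans hl, rfl⟩⟩

lemma IsReduced.of_cons {j : ι} {l : List ι} (h : IsReduced p (j :: l)) : IsReduced p l := by
  intro l' hl'
  have := h (j :: l') (by rw [word_cons, word_cons, hl'])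
  simpa using this

/-- Ping-pong: a reduced word maps the exterior into the ball of its first letter. If the second
letter does not commute with the first one, then its ball is outside that of the first letter.
Otherwise the two letters are exchanged, and the reflection in the ball of the second
letter preserves that of the first. -/
theorem IsReduced.mem_cap (hp : IsRightAngled p) {j : ι} {l : List ι}
    (h : IsReduced p (j :: l)) {x : S4} (hx : x ∈ exterior p) :
    toHomeomorph p (word p (j :: l)) x ∈ (p j).cap := by
  obtain ⟨n, hn⟩ : ∃ n, l.length = n := ⟨_, rfl⟩
  have apply_cons : ∀ (j : ι) (l : List ι), toHomeomorph p (word p (j :: l)) x =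
      (p j).reflection (toHomeomorph p (word p l) x) := fun j l => by
    rw [word_cons, map_mul, toHomeomorph_of]; rfl
  induction n generalizing j l with
  | zero =>
    obtain rfl := List.length_eq_zero_iff.1 hn
    rw [apply_cons, word_nil, map_one]
    exact RoundBall.reflection_mem_cap (mem_exterior.1 hx j)
  | succ n ih =>
    match l, hn with
    | i :: l, hn =>
      have hl : l.length = n := by simpa using hn
      have hi := ih h.of_cons hl
      by_cases hij : i = j
      · subst hij
        have := h l (by rw [word_cons, word_cons, ← mul_assoc, of_mul_of, one_mul])
        simp at this
      obtain ho | hd := hp j i (Ne.symm hij)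
      · have hswap : word p (j :: i :: l) = word p (i :: j :: l) := by
          rw [word_cons, word_cons, ← mul_assoc, of_comm ho, mul_assoc, ← word_cons, ← word_cons]
        have hred : IsReduced p (i :: j :: l) := fun l' hl' => by
          have := h l' (hl'.trans hswap.symm)
          simpa using this
        rw [hswap, apply_cons]
        exact ho.symm.reflection_mem_cap (ih hred.of_cons hl)
      · rw [apply_cons]
        exact RoundBall.reflection_mem_cap fun hmem =>
          disjoint_left.1 (RoundBall.disjoint_cap_closedCap hd) hmem hi

lemma exists_mem_cap (hp : IsRightAngled p) {w : CoxeterQuotient p} (hw : w ≠ 1) :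
    ∃ j, ∀ x ∈ exterior p, toHomeomorph p w x ∈ (p j).cap := by
  obtain ⟨l, rfl, hl⟩ := exists_isReduced w
  match l, hl with
  | [], _ => exact absurd word_nil hw
  | j :: l, hl => exact ⟨j, fun x hx => hl.mem_cap hp hx⟩

lemma toHomeomorph_injective (hp : IsRightAngled p) :
    Function.Injective (toHomeomorph p) := by
  rw [injective_iff_map_eq_one]
  intro w hw
  by_contra hne
  obtain ⟨j, hj⟩ := exists_mem_cap hp hne
  have := hj _ infty_mem_exterior
  rw [hw] at this
  exact RoundBall.infty_notMem_closedCap (RoundBall.cap_subset_closedCap this)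

lemma range_toHomeomorph : (toHomeomorph p).range = reflectionGroup p := by
  rw [MonoidHom.range_eq_map, ← PresentedGroup.closure_range_of, MonoidHom.map_closure,
    ← range_comp, reflectionGroup]
  rfl

/-- The right-angled Coxeter group is isomorphic to the reflection group. -/
theorem exists_mulEquiv (hp : IsRightAngled p) :
    ∃ e : CoxeterQuotient p ≃* reflectionGroup p,
      ∀ j, (e (PresentedGroup.of j) : S4 ≃ₜ S4) = (p j).reflection :=
  ⟨((toHomeomorph p).ofInjective (toHomeomorph_injective hp)).trans
    (MulEquiv.subgroupCongr range_toHomeomorph), fun j => toHomeomorph_of j⟩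

end CoxeterQuotient

open CoxeterQuotient

lemma exists_mem_cap_of_ne_one (hp : IsRightAngled p) {g : S4 ≃ₜ S4}
    (hg : g ∈ reflectionGroup p) (h1 : g ≠ 1) : ∃ j, ∀ x ∈ exterior p, g x ∈ (p j).cap := by
  rw [← range_toHomeomorph] at hg
  obtain ⟨w, rfl⟩ := hg
  exact exists_mem_cap hp fun hw => h1 (by rw [hw, map_one])

/-- The translates of the exterior are pairwise disjoint. -/
lemma eq_one_of_mem_exterior (hp : IsRightAngled p) {g : S4 ≃ₜ S4}
    (hg : g ∈ reflectionGroup p) {x : S4} (hx : x ∈ exterior p) (hgx : g x ∈ exterior p) :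
    g = 1 := by
  by_contra h1
  obtain ⟨j, hj⟩ := exists_mem_cap_of_ne_one hp hg h1
  exact mem_exterior.1 hgx j (RoundBall.cap_subset_closedCap (hj x hx))

lemma eq_of_mem_exterior (hp : IsRightAngled p) {g h : S4 ≃ₜ S4}
    (hg : g ∈ reflectionGroup p) (hh : h ∈ reflectionGroup p) {x y : S4}
    (hx : x ∈ exterior p) (hy : y ∈ exterior p) (hxy : g x = h y) : g = h := by
  have h1 : (h⁻¹ * g) x = y := by
    have : (h⁻¹ * g) x = h.symm (g x) := rfl
    rw [this, hxy, h.symm_apply_apply]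
  have h2 := eq_one_of_mem_exterior hp (mul_mem (inv_mem hh) hg) hx (h1 ▸ hy)
  exact (inv_mul_eq_one.1 h2).symm

end

section

/-! ### Orbits and the discontinuity set -/

lemma apply_mem_discontinuitySet {G : Subgroup (S4 ≃ₜ S4)} {g : S4 ≃ₜ S4} (hg : g ∈ G) {x : S4}
    (hx : x ∈ discontinuitySet G) : g x ∈ discontinuitySet G := by
  obtain ⟨U, hU, hfin⟩ := hx
  refine ⟨g '' U, g.isOpenMap.image_mem_nhds hU, (hfin.image fun k => g * k * g⁻¹).subset ?_⟩
  rintro k ⟨hk, y, ⟨u, hu, rfl⟩, z, ⟨v, hv, rfl⟩, hz⟩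
  refine ⟨g⁻¹ * k * g, ⟨mul_mem (mul_mem (inv_mem hg) hk) hg, u, hu, v, hv, ?_⟩, by group⟩
  have : (g⁻¹ * k * g) v = g.symm (k (g v)) := rfl
  rw [this, hz, g.symm_apply_apply]

variable {ι : Type} {p : ι → RoundBall}

lemma exists_isConformalFactor {g : S4 ≃ₜ S4} (hg : g ∈ reflectionGroup p) :
    ∃ l, IsConformalFactor g l := by
  induction hg using Subgroup.closure_induction with
  | mem x hx =>
    obtain ⟨j, rfl⟩ := hx
    exact ⟨_, (p j).isConformalFactor⟩
  | one => exact ⟨_, .one⟩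
  | mul x y _ _ hx hy => exact ⟨_, hx.choose_spec.mul hy.choose_spec⟩
  | inv x _ hx => exact ⟨_, hx.choose_spec.inv⟩

lemma exists_norm_le_of_mem_closedCap [Finite ι] (p : ι → RoundBall) :
    ∃ M : ℝ, 0 < M ∧ ∀ j, ∀ x ∈ (p j).closedCap, ∃ y : R4, ‖y‖ ≤ M ∧ x = (y : S4) := by
  have h : Bornology.IsBounded (⋃ j, (p j).solid) :=
    Bornology.isBounded_iUnion.2 fun j => Metric.isBounded_closedBall
  obtain ⟨M, hM, hb⟩ := h.exists_pos_norm_le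
  refine ⟨M, hM, ?_⟩
  rintro j x ⟨y, hy, rfl⟩
  exact ⟨y, hb y (mem_iUnion.2 ⟨j, hy⟩), rfl⟩

/-- The orbit of `∞` is uniformly separated along group elements whose conformal factor at `∞` is
bounded below, so there are only finitely many such elements. -/
lemma finite_factor_infty_ge [Finite ι] (hp : IsRightAngled p) {ε : ℝ} (hε : 0 < ε) :
    {g | g ∈ reflectionGroup p ∧ ∃ l, IsConformalFactor g l ∧ ε ≤ l OnePoint.infty}.Finite := by
  obtain ⟨M, hM, hb⟩ := exists_norm_le_of_mem_closedCap p
  have orbit : ∀ g ∈ reflectionGroup p, g ≠ 1 →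
      ∃ y : R4, ‖y‖ ≤ M ∧ g OnePoint.infty = (y : S4) := by
    intro g hg h1
    obtain ⟨j, hj⟩ := exists_mem_cap_of_ne_one hp hg h1
    exact hb j _ (RoundBall.cap_subset_closedCap (hj _ infty_mem_exterior))
  choose! b hbM hb using orbit
  by_contra hinf
  have hinf := (Set.not_finite.1 hinf).sdiff (finite_singleton 1)
  obtain ⟨t, -, htf, ht⟩ := (isCompact_closedBall (0 : R4) M).finite_cover_balls
    (e := ε / (4 * M)) (by positivity)
  have hmem : ∀ g ∈ reflectionGroup p, g ≠ 1 → ∃ c ∈ t, dist (b g) c < ε / (4 * M) := by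
    intro g hg h1
    have := ht (mem_closedBall_zero_iff.2 (hbM g hg h1))
    simpa using this
  choose! c hct hc using hmem
  obtain ⟨g, ⟨⟨hg, l, hl, hlε⟩, hg1⟩, g', ⟨⟨hg', -⟩, hg1'⟩, hne, heq⟩ :=
    hinf.exists_ne_map_eq_of_mapsTo (f := c) (fun g hg => hct g hg.1.1 hg.2) htf
  have hclose : dist (b g) (b g') < ε / (2 * M) := by
    have h1 := hc g hg hg1
    have h2 := hc g' hg' hg1'
    rw [← heq] at h2
    have h3 := dist_triangle_right (b g) (b g') (c g)
    have h4 : ε / (4 * M) + ε / (4 * M) = ε / (2 * M) := by field_simp; ring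
    linarith
  have hinv1 : g⁻¹ ≠ 1 := fun h => hg1 (inv_eq_one.1 h)
  have hk : g⁻¹ * g' ∈ reflectionGroup p := mul_mem (inv_mem hg) hg'
  have hk1 : g⁻¹ * g' ≠ 1 := fun h => hne (inv_mul_eq_one.1 h)
  have ha := hb _ (inv_mem hg) hinv1
  have hy := hb _ hk hk1
  have hga : g (b g⁻¹ : S4) = OnePoint.infty := by rw [← ha]; exact g.apply_symm_apply _
  have hgy : g (b (g⁻¹ * g') : S4) = (b g' : S4) := by
    rw [← hy, ← hb g' hg' hg1']; exact g.apply_symm_apply _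
  have e1 := hl.2 (b (g⁻¹ * g') : S4) (b g⁻¹ : S4)
  have e2 := hl.2 OnePoint.infty (b g⁻¹ : S4)
  have e3 := hl.2 OnePoint.infty (b (g⁻¹ * g') : S4)
  rw [hga, hgy, chordal_coe_infty, chordal_coe_coe] at e1
  rw [hga, hb g hg hg1, chordal_coe_infty, chordal_infty_coe, mul_one] at e2
  rw [hgy, hb g hg hg1, chordal_coe_coe, chordal_infty_coe, mul_one] at e3
  have hd : dist (b (g⁻¹ * g')) (b g⁻¹) ≤ 2 * M := by
    have := dist_le_norm_add_norm (b (g⁻¹ * g')) (b g⁻¹)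
    have := hbM _ hk hk1
    have := hbM _ (inv_mem hg) hinv1
    linarith
  have p1 := hl.1 (b (g⁻¹ * g') : S4)
  have p2 := hl.1 (b g⁻¹ : S4)
  -- The conformal factors at `g⁻¹ ∞` cancel from the transformation rules at the other points.
  have e4 : l (b (g⁻¹ * g') : S4) * dist (b (g⁻¹ * g')) (b g⁻¹) ^ 2 = l OnePoint.infty := by
    apply mul_right_cancel₀ p2.ne'
    rw [← e2, e1]
    ring
  have h5 : dist (b (g⁻¹ * g')) (b g⁻¹) ^ 2 ≤ (2 * M) ^ 2 := by gcongr
  have h6 : ε ≤ l (b (g⁻¹ * g') : S4) * (2 * M) ^ 2 := by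
    refine hlε.trans (e4 ▸ ?_)
    gcongr
  have h7 : ε * ε ≤ dist (b g) (b g') ^ 2 * (2 * M) ^ 2 := by
    rw [e3]
    have h0 := hl.1 OnePoint.infty
    calc ε * ε ≤ l OnePoint.infty * (l (b (g⁻¹ * g') : S4) * (2 * M) ^ 2) := by gcongr
      _ = _ := by ring
  have h8 : dist (b g) (b g') * (2 * M) < ε := (lt_div_iff₀ (by positivity)).1 hclose
  have h9 : 0 ≤ dist (b g) (b g') * (2 * M) := by positivity
  nlinarith

/-- Every orbit in the discontinuity set meets the complement of the open balls. Indeed inversions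
expand inside their balls, so if the orbit of `x` stays in the open balls, then no element
of the group has maximal conformal factor at `x`; hence infinitely many elements `g` have
conformal factor at least `1` at `x`, and the points `g⁻¹ ∞` accumulate at `x`. -/
theorem exists_apply_mem_closedExterior [Finite ι] (hp : IsRightAngled p) {x : S4}
    (hx : x ∈ discontinuitySet (reflectionGroup p)) :
    ∃ g ∈ reflectionGroup p, g x ∈ closedExterior p := by
  by_contra! hcon
  have hcap : ∀ g ∈ reflectionGroup p, ∃ j, g x ∈ (p j).cap := fun g hg => by
    have := hcon g hg
    rw [mem_closedExterior] at this
    push Not at this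
    exact this
  have hfin : ∀ g ∈ reflectionGroup p, ∃ y : R4, g x = (y : S4) := fun g hg => by
    obtain ⟨j, y, -, hy⟩ := hcap g hg
    exact ⟨y, hy.symm⟩
  have hΛ := fun g hg => exists_isConformalFactor (p := p) (g := g) hg
  choose! Λ hΛ using hΛ
  set S := {g | g ∈ reflectionGroup p ∧ 1 ≤ Λ g x} with hS
  have h1S : (1 : S4 ≃ₜ S4) ∈ S :=
    ⟨one_mem _, by rw [(hΛ 1 (one_mem _)).unique .one]⟩
  have hSinf : S.Infinite := by
    intro hSf
    obtain ⟨g, ⟨hg, hg1⟩, hmax⟩ := Set.exists_max_image S (fun g => Λ g x) hSf ⟨1, h1S⟩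
    obtain ⟨j, hj⟩ := hcap g hg
    have hm : (p j).reflection * g ∈ reflectionGroup p :=
      mul_mem (reflection_mem_reflectionGroup j) hg
    have hc : g x ≠ ((p j).center : S4) := by
      intro hc
      obtain ⟨y, hy⟩ := hfin _ hm
      have : ((p j).reflection * g) x = (p j).reflection (g x) := rfl
      rw [this, hc] at hy
      exact OnePoint.coe_ne_infty y (hy.symm.trans (p j).reflectionFun_center)
    have hlt := RoundBall.one_lt_factor hj hc
    have heq := congrFun ((hΛ _ hm).unique ((p j).isConformalFactor.mul (hΛ g hg))) x
    have hpos := (hΛ g hg).1 x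
    have hgt : Λ g x < Λ ((p j).reflection * g) x := by rw [heq]; nlinarith
    exact absurd (hmax _ ⟨hm, by linarith⟩) (not_le.2 hgt)
  obtain ⟨x0, hx0⟩ := hfin 1 (one_mem _)
  obtain rfl : x = (x0 : S4) := hx0
  obtain ⟨U, hU, hUf⟩ := hx
  have hU' : ((↑) : R4 → S4) ⁻¹' U ∈ 𝓝 x0 := OnePoint.continuous_coe.continuousAt hU
  obtain ⟨δ, hδ, hball⟩ := Metric.mem_nhds_iff.1 hU'
  have hT := (hSinf.sdiff (finite_factor_infty_ge hp (ε := δ ^ 2) (by positivity))).sdiff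
    (finite_singleton 1)
  set T := (S \ {g | g ∈ reflectionGroup p ∧
    ∃ l, IsConformalFactor g l ∧ δ ^ 2 ≤ l OnePoint.infty}) \ {1} with hTdef
  -- The distance of `x` from `g⁻¹ ∞` is the root of the quotient of the factors at `∞` and `x`.
  have hinvU : ∀ g ∈ T, g⁻¹ OnePoint.infty ∈ U := by
    rintro g ⟨⟨⟨hg, hg1⟩, hsmall⟩, hne⟩
    have hsm : Λ g OnePoint.infty < δ ^ 2 := by
      by_contra! h
      exact hsmall ⟨hg, _, hΛ g hg, h⟩
    have fin : ∀ k ∈ reflectionGroup p, k ≠ 1 → ∃ y : R4, k OnePoint.infty = (y : S4) := by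
      intro k hk hk1
      obtain ⟨j, hj⟩ := exists_mem_cap_of_ne_one hp hk hk1
      obtain ⟨y, -, hy⟩ := hj _ infty_mem_exterior
      exact ⟨y, hy.symm⟩
    obtain ⟨a, ha⟩ := fin g⁻¹ (inv_mem hg) fun h => hne (inv_eq_one.1 h)
    obtain ⟨b, hb⟩ := fin g hg hne
    obtain ⟨y, hy⟩ := hfin g hg
    have hga : g (a : S4) = OnePoint.infty := by rw [← ha]; exact g.apply_symm_apply _
    have e1 := (hΛ g hg).2 (x0 : S4) (a : S4)
    have e2 := (hΛ g hg).2 OnePoint.infty (a : S4)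
    rw [hga, hy, chordal_coe_infty, chordal_coe_coe] at e1
    rw [hga, hb, chordal_coe_infty, chordal_infty_coe, mul_one] at e2
    have p2 := (hΛ g hg).1 (a : S4)
    have e4 : Λ g (x0 : S4) * dist x0 a ^ 2 = Λ g OnePoint.infty := by
      apply mul_right_cancel₀ p2.ne'
      rw [← e2, e1]
      ring
    have hd : dist x0 a ^ 2 < δ ^ 2 := by
      nlinarith [sq_nonneg (dist x0 a)]
    have hd' : dist x0 a < δ := lt_of_pow_lt_pow_left₀ 2 hδ.le hd
    rw [ha]
    exact hball (Metric.mem_ball'.2 hd')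
  obtain ⟨g0, hg0⟩ := hT.nonempty
  refine hT ((hUf.preimage (f := fun g : S4 ≃ₜ S4 => g⁻¹ * g0) ?_).subset ?_)
  · exact fun g _ g' _ h => inv_injective (mul_right_cancel h)
  · intro g hg
    refine ⟨mul_mem (inv_mem hg.1.1.1) hg0.1.1.1, g⁻¹ OnePoint.infty, hinvU g hg,
      g0⁻¹ OnePoint.infty, hinvU g0 hg0, ?_⟩
    have : (g⁻¹ * g0) (g0⁻¹ OnePoint.infty) = g⁻¹ (g0 (g0.symm OnePoint.infty)) := rfl
    rw [this, g0.apply_symm_apply]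

/-- Two balls of the family that are not orthogonal generate a free product of groups of order
two, so their common boundary points are not in the discontinuity set. -/
lemma orthogonal_of_mem_rim (hp : IsRightAngled p) {x : S4}
    (hx : x ∈ discontinuitySet (reflectionGroup p)) {i j : ι} (hij : i ≠ j)
    (hi : x ∈ (p i).rim) (hj : x ∈ (p j).rim) : (p i).Orthogonal (p j) := by
  by_contra hno
  have hd := Or.resolve_left (hp i j hij) hno
  have hd' : (p j).radius + (p i).radius ≤ dist (p j).center (p i).center := by
    rwa [add_comm, dist_comm]
  set g := (p i).reflection * (p j).reflection with hg
  have hgG : g ∈ reflectionGroup p :=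
    mul_mem (reflection_mem_reflectionGroup i) (reflection_mem_reflectionGroup j)
  have happ : ∀ y, g y = (p i).reflection ((p j).reflection y) := fun y => rfl
  -- Each reflection maps the exterior of its own ball, in particular the other ball, into its ball.
  have hpow : ∀ n : ℕ, (g ^ (n + 1)) OnePoint.infty ∈ (p i).cap := by
    have hout : ∀ y, y ∉ (p j).closedCap → g y ∈ (p i).cap := fun y hy => by
      rw [happ]
      exact RoundBall.reflection_mem_cap fun hmem =>
        disjoint_left.1 (RoundBall.disjoint_cap_closedCap hd) hmem
          (RoundBall.reflection_mem_cap hy)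
    intro n
    induction n with
    | zero => simpa using hout _ RoundBall.infty_notMem_closedCap
    | succ n ih =>
      rw [pow_succ']
      exact hout _ fun hmem =>
        disjoint_left.1 (RoundBall.disjoint_cap_closedCap hd') hmem ih
  have hone : ∀ n : ℕ, g ^ (n + 1) ≠ 1 := fun n h => by
    have := hpow n
    rw [h] at this
    exact RoundBall.infty_notMem_closedCap (RoundBall.cap_subset_closedCap this)
  have hfix : ∀ n : ℕ, (g ^ n) x = x := by
    intro n
    induction n with
    | zero => rfl
    | succ n ih =>
      have : (g ^ (n + 1)) x = (g ^ n) (g x) := by rw [pow_succ]; rfl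
      rw [this, happ, RoundBall.reflection_of_mem_rim hj, RoundBall.reflection_of_mem_rim hi, ih]
  obtain ⟨U, hU, hfin⟩ := hx
  have hxU := mem_of_mem_nhds hU
  have hfin' : (range fun n : ℕ => g ^ n).Finite := hfin.subset (by
    rintro _ ⟨n, rfl⟩
    exact ⟨pow_mem hgG n, x, hxU, x, hxU, hfix n⟩)
  have hord : IsOfFinOrder g := isOfFinOrder_iff_pow_eq_one.2 (by
    obtain ⟨a, b, hab, he⟩ : ∃ a b : ℕ, a < b ∧ g ^ a = g ^ b := by
      by_contra! hne
      refine infinite_range_of_injective (fun a b he => ?_) hfin'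
      obtain h | h | h := lt_trichotomy a b
      · exact absurd he (hne a b h)
      · exact h
      · exact absurd he.symm (hne b a h)
    exact ⟨b - a, by omega, by rw [pow_sub _ hab.le, ← he, mul_inv_cancel]⟩)
  obtain ⟨n, hn, hgn⟩ := isOfFinOrder_iff_pow_eq_one.1 hord
  obtain ⟨n, rfl⟩ := Nat.exists_eq_succ_of_ne_zero hn.ne'
  exact hone n hgn

/-! ### Local structure at points of the closed exterior -/

variable (p) in
/-- The point lies outside the open balls, and the spheres through it are pairwise orthogonal. -/
def IsRegularPoint (x : S4) : Prop :=
  x ∈ closedExterior p ∧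
    ∀ i j, i ≠ j → x ∈ (p i).rim → x ∈ (p j).rim → (p i).Orthogonal (p j)

lemma mem_closedCap_iff_mem_rim {x : S4} (hx : x ∈ closedExterior p) (j : ι) :
    x ∈ (p j).closedCap ↔ x ∈ (p j).rim := by
  refine ⟨fun h => ?_, fun h => RoundBall.rim_subset_closedCap h⟩
  rw [← RoundBall.closedCap_diff_cap]
  exact ⟨h, mem_closedExterior.1 hx j⟩

lemma eventually_mem_closedCap_imp_mem_rim [Finite ι] {x : S4} (hx : x ∈ closedExterior p) :
    ∀ᶠ y in 𝓝 x, ∀ j, y ∈ (p j).closedCap → x ∈ (p j).rim := by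
  rw [eventually_all]
  intro j
  by_cases h : x ∈ (p j).rim
  · exact Eventually.of_forall fun _ _ => h
  · have : x ∉ (p j).closedCap := fun h' => h ((mem_closedCap_iff_mem_rim hx j).1 h')
    filter_upwards [RoundBall.isClosed_closedCap.isOpen_compl.mem_nhds this] with y hy hy'
    exact absurd hy' hy

/-- The radii at a common point of orthogonal spheres are orthogonal. -/
lemma RoundBall.Orthogonal.inner_sub_center {B B' : RoundBall} (h : B.Orthogonal B') {x : R4}
    (hx : dist x B.center = B.radius) (hx' : dist x B'.center = B'.radius) :
    Inner.inner ℝ (x - B.center) (x - B'.center) = 0 := by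
  have e : x - B'.center - (x - B.center) = B.center - B'.center := by abel
  have h1 := @norm_sub_sq_real _ _ _ (x - B'.center) (x - B.center)
  rw [e, ← dist_eq_norm, ← dist_eq_norm, ← dist_eq_norm, hx, hx', h] at h1
  rw [real_inner_comm]
  linarith

/-- Moving away from the centres of all the spheres through a regular point leads out of all the
closed balls. -/
lemma IsRegularPoint.mem_closure_exterior [Finite ι] {x : S4} (hx : IsRegularPoint p x) :
    x ∈ closure (exterior p) := by
  classical
  have := Fintype.ofFinite ι
  induction x using OnePoint.rec with
  | infty => exact subset_closure infty_mem_exterior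
  | coe x =>
    set v : R4 := ∑ j with (x : S4) ∈ (p j).rim, (x - (p j).center) with hv
    have hc : Tendsto (fun t : ℝ => ((x + t • v : R4) : S4)) (𝓝[>] 0) (𝓝 (x : S4)) := by
      have : Continuous fun t : ℝ => ((x + t • v : R4) : S4) :=
        OnePoint.continuous_coe.comp (by fun_prop)
      have h := this.tendsto 0
      rw [zero_smul, add_zero] at h
      exact h.mono_left nhdsWithin_le_nhds
    refine mem_closure_of_tendsto hc ?_
    filter_upwards [hc.eventually (eventually_mem_closedCap_imp_mem_rim hx.1),
      self_mem_nhdsWithin] with t ht ht0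
    refine mem_exterior.2 fun j hj => ?_
    have hjx := ht j hj
    have hr := (p j).radius_pos
    rw [RoundBall.coe_mem_closedCap] at hj
    have hxj := RoundBall.coe_mem_rim.1 hjx
    have hin : Inner.inner ℝ (x - (p j).center) v = (p j).radius ^ 2 := by
      rw [hv, inner_sum, Finset.sum_eq_single_of_mem j (by simpa using hjx)]
      · rw [real_inner_self_eq_norm_sq, ← dist_eq_norm, hxj]
      · intro i hi hij
        have hi' : (x : S4) ∈ (p i).rim := by simpa using hi
        exact (hx.2 j i (Ne.symm hij) hjx hi').inner_sub_center hxj (RoundBall.coe_mem_rim.1 hi')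
    have ht0 : (0 : ℝ) < t := ht0
    have e : x + t • v - (p j).center = (x - (p j).center) + t • v := by abel
    have hsq : dist (x + t • v) (p j).center ^ 2 ≤ (p j).radius ^ 2 := by gcongr
    rw [dist_eq_norm, e, @norm_add_sq_real, real_inner_smul_right, hin, ← dist_eq_norm, hxj] at hsq
    have : 0 < t * (p j).radius ^ 2 := by positivity
    nlinarith [sq_nonneg ‖t • v‖]

/-- Finitely many products of commuting reflections fixing `x` suffice to move every point out of
the balls whose boundaries pass through `x`. -/
lemma exists_finite_fixing (J : Finset ι)
    (hJ : ∀ i ∈ J, ∀ j ∈ J, i ≠ j → (p i).Orthogonal (p j)) {x : S4}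
    (hx : ∀ j ∈ J, x ∈ (p j).rim) :
    ∃ F : Set (S4 ≃ₜ S4), F.Finite ∧ (∀ h ∈ F, h ∈ reflectionGroup p ∧ h x = x) ∧
      ∀ y, ∃ h ∈ F, ∀ j ∈ J, h y ∉ (p j).cap := by
  classical
  induction J using Finset.induction_on with
  | empty => exact ⟨{1}, finite_singleton 1, by simp [one_mem], fun y => ⟨1, rfl, by simp⟩⟩
  | insert j J hj ih =>
    obtain ⟨F, hF, hFx, hFy⟩ := ih
      (fun i hi k hk => hJ i (Finset.mem_insert_of_mem hi) k (Finset.mem_insert_of_mem hk))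
      fun i hi => hx i (Finset.mem_insert_of_mem hi)
    refine ⟨F ∪ (fun h => (p j).reflection * h) '' F, hF.union (hF.image _), ?_, fun y => ?_⟩
    · rintro h (hh | ⟨h, hh, rfl⟩)
      · exact hFx h hh
      · refine ⟨mul_mem (reflection_mem_reflectionGroup j) (hFx h hh).1, ?_⟩
        have : ((p j).reflection * h) x = (p j).reflection (h x) := rfl
        rw [this, (hFx h hh).2, RoundBall.reflection_of_mem_rim (hx j (Finset.mem_insert_self j J))]
    · obtain ⟨h, hh, hy⟩ := hFy y
      by_cases hc : h y ∈ (p j).cap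
      · refine ⟨(p j).reflection * h, .inr ⟨h, hh, rfl⟩, fun i hi hmem => ?_⟩
        have hmem : (p j).reflection (h y) ∈ (p i).cap := hmem
        obtain rfl | hi := Finset.mem_insert.1 hi
        · exact RoundBall.reflection_notMem_closedCap hc (RoundBall.cap_subset_closedCap hmem)
        · have ho := hJ j (Finset.mem_insert_self j J) i (Finset.mem_insert_of_mem hi)
            fun h => hj (h ▸ hi)
          have := ho.reflection_mem_cap hmem
          rw [RoundBall.reflection_reflection] at this
          exact hy i hi this
      · refine ⟨h, .inl hh, fun i hi => ?_⟩
        obtain rfl | hi := Finset.mem_insert.1 hi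
        · exact hc
        · exact hy i hi

/-- A regular point has a neighbourhood which meets finitely many translates of the exterior, and
which finitely many elements of the group carry to sets meeting it. -/
lemma IsRegularPoint.exists_nhds [Finite ι] (hp : IsRightAngled p) {x : S4}
    (hx : IsRegularPoint p x) : ∃ V ∈ 𝓝 x,
      {g | g ∈ reflectionGroup p ∧ (g '' exterior p ∩ V).Nonempty}.Finite ∧
      {g | g ∈ reflectionGroup p ∧ (V ∩ g '' V).Nonempty}.Finite := by
  classical
  have := Fintype.ofFinite ι
  obtain ⟨F, hF, hFx, hFy⟩ := exists_finite_fixing (p := p)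
    (Finset.univ.filter fun j => x ∈ (p j).rim)
    (fun i hi j hj hij => hx.2 i j hij (by simpa using hi) (by simpa using hj))
    (x := x) (fun j hj => by simpa using hj)
  have hV0 := eventually_mem_closedCap_imp_mem_rim hx.1
  have hV1 : ∀ᶠ y in 𝓝 x, ∀ h ∈ F, ∀ j, h y ∈ (p j).closedCap → x ∈ (p j).rim := by
    rw [hF.eventually_all]
    intro h hh
    have hc := h.continuous.tendsto x
    rw [(hFx h hh).2] at hc
    exact hc.eventually hV0
  obtain ⟨V, hV, hVo, hxV⟩ := eventually_nhds_iff.1 hV1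
  -- The neighbourhood is covered by the translates of the regular points under `F⁻¹`.
  have hE : ∀ y ∈ V, ∃ h ∈ F, IsRegularPoint p (h y) := by
    intro y hy
    obtain ⟨h, hh, hhy⟩ := hFy y
    have hj := hV y hy h hh
    refine ⟨h, hh, mem_closedExterior.2 fun j hc => ?_, fun i j hij hi hj' => ?_⟩
    · exact hhy j (by simpa using hj j (RoundBall.cap_subset_closedCap hc)) hc
    · exact hx.2 i j hij (hj i (RoundBall.rim_subset_closedCap hi))
        (hj j (RoundBall.rim_subset_closedCap hj'))
  have hD : ∀ g ∈ reflectionGroup p, ∀ d ∈ exterior p, g d ∈ V → g⁻¹ ∈ F := by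
    intro g hg d hd hgd
    obtain ⟨h, hh, hreg⟩ := hE _ hgd
    have : h * g = 1 := by
      by_contra hne
      obtain ⟨j, hj⟩ := exists_mem_cap_of_ne_one hp (mul_mem (hFx h hh).1 hg) hne
      exact mem_closedExterior.1 hreg.1 j (hj d hd)
    rwa [inv_eq_of_mul_eq_one_left this]
  refine ⟨V, hVo.mem_nhds hxV, hF.inv.subset ?_, (hF.inv.mul hF).subset ?_⟩
  · rintro g ⟨hg, y, ⟨d, hd, rfl⟩, hy⟩
    exact hD g hg d hd hy
  · rintro g ⟨hg, y, hy, z, hz, rfl⟩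
    obtain ⟨h, hh, hreg⟩ := hE z hz
    have hopen : IsOpen ((g * h⁻¹) ⁻¹' V) := hVo.preimage (g * h⁻¹).continuous
    have hmem : h z ∈ (g * h⁻¹) ⁻¹' V := by
      have : (g * h⁻¹) (h z) = g (h.symm (h z)) := rfl
      rw [mem_preimage, this, h.symm_apply_apply]
      exact hy
    obtain ⟨d, hdV, hd⟩ := mem_closure_iff.1 hreg.mem_closure_exterior _ hopen hmem
    have := hD _ (mul_mem hg (inv_mem (hFx h hh).1)) d hd hdV
    exact ⟨g * h⁻¹, this, h, hh, by group⟩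

lemma closure_exterior_subset : closure (exterior p) ⊆ closedExterior p :=
  closure_minimal exterior_subset_closedExterior isClosed_closedExterior

/-- The points of the closed fundamental domain are the regular points. -/
theorem closure_exterior_inter_discontinuitySet [Finite ι] (hp : IsRightAngled p) :
    closure (exterior p) ∩ discontinuitySet (reflectionGroup p) = {x | IsRegularPoint p x} := by
  ext x
  constructor
  · rintro ⟨hx, hΩ⟩
    exact ⟨closure_exterior_subset hx, fun i j hij => orthogonal_of_mem_rim hp hΩ hij⟩
  · intro hx
    obtain ⟨V, hV, -, hfin⟩ := IsRegularPoint.exists_nhds hp hx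
    exact ⟨IsRegularPoint.mem_closure_exterior hx, V, hV, hfin⟩

lemma isRegularPoint_of_mem [Finite ι] (hp : IsRightAngled p) {x : S4}
    (hx : x ∈ closedExterior p) (hΩ : x ∈ discontinuitySet (reflectionGroup p)) :
    IsRegularPoint p x :=
  ⟨hx, fun _ _ hij => orthogonal_of_mem_rim hp hΩ hij⟩

lemma isRegularPoint_of_mem_exterior {x : S4} (hx : x ∈ exterior p) : IsRegularPoint p x :=
  ⟨exterior_subset_closedExterior hx, fun i _ _ hi =>
    absurd (RoundBall.rim_subset_closedCap hi) (mem_exterior.1 hx i)⟩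

/-- The group is discrete, because the exterior is an open set disjoint from its translates. -/
theorem isDiscreteGroup_reflectionGroup [Finite ι] (hp : IsRightAngled p) :
    IsDiscreteGroup (reflectionGroup p) := by
  rw [IsDiscreteGroup, isDiscrete_iff_forall_mem_exists_isOpen]
  rintro _ ⟨g, hg, rfl⟩
  refine ⟨{f : C(S4, S4) | f OnePoint.infty ∈ g '' exterior p}, ?_, ?_⟩
  · exact (g.isOpenMap _ isOpen_exterior).preimage (ContinuousEvalConst.continuous_eval_const _)
  · ext f
    constructor
    · rintro ⟨⟨d, hd, hdf⟩, k, hk, rfl⟩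
      have : g = k := eq_of_mem_exterior hp hg hk hd infty_mem_exterior hdf
      rw [this]; rfl
    · rintro rfl
      exact ⟨⟨_, infty_mem_exterior, rfl⟩, g, hg, rfl⟩

end

/-! ### Derivatives in the charts of the four-sphere -/

lemma finiteChart_coe (y : R4) : finiteChart (y : S4) = y :=
  OnePoint.isOpenEmbedding_coe.toOpenPartialHomeomorph_left_inv

lemma finiteChart_symm (y : R4) : finiteChart.symm y = (y : S4) := rfl

lemma inftyChart_apply (x : S4) : inftyChart x = finiteChart (RoundBall.unit.reflection x) := rfl

lemma inftyChart_symm (y : R4) : inftyChart.symm y = RoundBall.unit.reflection (y : S4) := rfl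

lemma inftyChart_infty : inftyChart OnePoint.infty = 0 := finiteChart_coe 0

lemma chartAt_coe (y : R4) : chartAt R4 (y : S4) = finiteChart :=
  if_neg (OnePoint.coe_ne_infty y)

lemma chartAt_infty : chartAt R4 (OnePoint.infty : S4) = inftyChart := if_pos rfl

lemma contMDiffAt_and_scalarDeriv {f : S4 → ℝ} {φ : R4 → ℝ} (hf : ∀ y : R4, f (y : S4) = φ y)
    (hφ : ContDiff ℝ ∞ φ) (x : R4) :
    ContMDiffAt 𝓘(ℝ, R4) 𝓘(ℝ, ℝ) ∞ f (x : S4) ∧ scalarDeriv f (x : S4) = fderiv ℝ φ x := by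
  have hw : writtenInExtChartAt 𝓘(ℝ, R4) 𝓘(ℝ, ℝ) (x : S4) f = φ := by
    funext y
    simp [writtenInExtChartAt, extChartAt, chartAt_coe, finiteChart_symm, hf, chartAt_self_eq]
  have hp : extChartAt 𝓘(ℝ, R4) (x : S4) (x : S4) = x := by
    simp [extChartAt, chartAt_coe, finiteChart_coe]
  have hc : ContMDiffAt 𝓘(ℝ, R4) 𝓘(ℝ, ℝ) ∞ f (x : S4) := by
    rw [contMDiffAt_iff]
    constructor
    · rw [OnePoint.continuousAt_coe]
      exact (funext hf : f ∘ ((↑) : R4 → S4) = φ) ▸ hφ.continuous.continuousAt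
    · change ContDiffWithinAt ℝ ∞ (writtenInExtChartAt 𝓘(ℝ, R4) 𝓘(ℝ, ℝ) (x : S4) f) _ _
      rw [hw]
      exact hφ.contDiffAt.contDiffWithinAt
  refine ⟨hc, ?_⟩
  have hm : scalarDeriv f (x : S4) = fderivWithin ℝ
      (writtenInExtChartAt 𝓘(ℝ, R4) 𝓘(ℝ, ℝ) (x : S4) f) (range 𝓘(ℝ, R4))
      (extChartAt 𝓘(ℝ, R4) (x : S4) (x : S4)) :=
    (hc.mdifferentiableAt (by simp)).mfderiv
  rw [hm, hw, hp]
  simp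

/-- Smoothness and conformality at a point are read off from the expression of the map in the
charts. -/
lemma contMDiffAt_and_isConformalMap {f : S4 → S4} {φ : R4 → R4} {L : R4 →L[ℝ] R4} {x : S4}
    {z : R4} (hz : chartAt R4 x x = z) (hf : ContinuousAt f x)
    (heq : (fun y => chartAt R4 (f x) (f ((chartAt R4 x).symm y))) =ᶠ[𝓝 z] φ)
    (hφ : ContDiffAt ℝ ∞ φ z) (hL : HasFDerivAt φ L z) (hconf : IsConformalMap L) :
    ContMDiffAt 𝓘(ℝ, R4) 𝓘(ℝ, R4) ∞ f x ∧ IsConformalMap (sphereDeriv f x) := by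
  have hw : writtenInExtChartAt 𝓘(ℝ, R4) 𝓘(ℝ, R4) x f =
      fun y => chartAt R4 (f x) (f ((chartAt R4 x).symm y)) := by
    funext y
    simp [writtenInExtChartAt, extChartAt]
  have hp : extChartAt 𝓘(ℝ, R4) x x = z := by
    simp [extChartAt, hz]
  have hc : ContMDiffAt 𝓘(ℝ, R4) 𝓘(ℝ, R4) ∞ f x := by
    rw [contMDiffAt_iff]
    refine ⟨hf, ?_⟩
    change ContDiffWithinAt ℝ ∞ (writtenInExtChartAt 𝓘(ℝ, R4) 𝓘(ℝ, R4) x f) _ _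
    rw [hw, hp]
    exact (hφ.congr_of_eventuallyEq heq).contDiffWithinAt
  refine ⟨hc, ?_⟩
  have hm : sphereDeriv f x = fderivWithin ℝ (writtenInExtChartAt 𝓘(ℝ, R4) 𝓘(ℝ, R4) x f)
      (range 𝓘(ℝ, R4)) (extChartAt 𝓘(ℝ, R4) x x) :=
    (hc.mdifferentiableAt (by simp)).mfderiv
  rw [hm, hw, hp]
  have : fderivWithin ℝ (fun y => chartAt R4 (f x) (f ((chartAt R4 x).symm y)))
      (range 𝓘(ℝ, R4)) z = L := by
    simpa using (hL.congr_of_eventuallyEq heq).fderiv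
  rw [this]
  exact hconf

/-! ### Inversions are Möbius transformations -/

/-- An inversion is of this form in the charts at its centre and at `∞`. -/
lemma hasFDerivAt_smul_quadratic {k : R4 → ℝ} (hk : DifferentiableAt ℝ k 0) (a : ℝ) (w : R4) :
    HasFDerivAt (fun u => k u • (a • u + ‖u‖ ^ 2 • w))
      ((k 0 * a) • ContinuousLinearMap.id ℝ R4) 0 := by
  have h1 : HasFDerivAt (fun u : R4 => ‖u‖ ^ 2 • w) (0 : R4 →L[ℝ] R4) 0 := by
    have h := ((hasFDerivAt_id (𝕜 := ℝ) (0 : R4)).norm_sq).smul_const w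
    refine h.congr_fderiv ?_
    ext v
    simp
  have h2 := ((hasFDerivAt_id (𝕜 := ℝ) (0 : R4)).const_smul a).add h1
  refine (hk.hasFDerivAt.smul h2).congr_fderiv ?_
  ext v
  simp [mul_smul]

lemma contDiff_quadratic (a : ℝ) (w : R4) : ContDiff ℝ ∞ fun u : R4 => a • u + ‖u‖ ^ 2 • w :=
  (contDiff_id.const_smul a).add ((contDiff_norm_sq ℝ).smul_const w)

lemma inversion_formula (c y : R4) (r : ℝ) :
    EuclideanGeometry.inversion c r y = (r ^ 2 / ‖y - c‖ ^ 2) • (y - c) + c := by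
  rw [EuclideanGeometry.inversion, div_pow, dist_eq_norm]; rfl

namespace RoundBall

lemma unit_reflection_coe {y : R4} (hy : y ≠ 0) :
    unit.reflection (y : S4) = (((‖y‖ ^ 2)⁻¹ • y : R4) : S4) := by
  have h : unit.reflection (y : S4) = _ := unit.reflectionFun_coe hy
  rw [h, inversion_formula]
  simp [unit]

lemma contMDiffAt_reflection_infty (B : RoundBall) :
    ContMDiffAt 𝓘(ℝ, R4) 𝓘(ℝ, R4) ∞ B.reflection OnePoint.infty ∧
      IsConformalMap (sphereDeriv B.reflection OnePoint.infty) := by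
  have hr := B.radius_pos
  set c := B.center with hc
  have hinf : B.reflection OnePoint.infty = (c : S4) := rfl
  set den : R4 → ℝ := fun u => 1 - 2 * Inner.inner ℝ u c + ‖u‖ ^ 2 * ‖c‖ ^ 2 with hden
  have hden1 : ContDiff ℝ ∞ den := by
    have h1 : ContDiff ℝ ∞ fun u : R4 => ‖u‖ ^ 2 := contDiff_norm_sq ℝ
    have h2 : ContDiff ℝ ∞ fun u : R4 => (Inner.inner ℝ u c : ℝ) :=
      contDiff_id.inner ℝ contDiff_const
    exact (contDiff_const.sub (contDiff_const.mul h2)).add (h1.mul contDiff_const)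
  have hden0 : den 0 = 1 := by simp [hden]
  have hne : ∀ᶠ u in 𝓝 (0 : R4), den u ≠ 0 :=
    hden1.continuous.continuousAt.eventually_ne (by rw [hden0]; exact one_ne_zero)
  have hk : ContDiffAt ℝ ∞ (fun u => B.radius ^ 2 / den u) 0 :=
    contDiffAt_const.div hden1.contDiffAt (by rw [hden0]; exact one_ne_zero)
  refine contMDiffAt_and_isConformalMap
    (φ := fun u => (B.radius ^ 2 / den u) • ((1 : ℝ) • u + ‖u‖ ^ 2 • (-c)) + c)
    (z := 0) (by rw [chartAt_infty, inftyChart_infty]) B.reflection.continuous.continuousAt ?_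
    ((hk.smul (contDiff_quadratic _ _).contDiffAt).add contDiffAt_const)
    ((hasFDerivAt_smul_quadratic (hk.differentiableAt (by simp)) 1 (-c)).add_const c)
    (isConformalMap_const_smul (by simp [hden0, hr.ne']))
  rw [hinf, chartAt_coe, chartAt_infty]
  filter_upwards [hne] with u hu
  rw [inftyChart_symm]
  by_cases hu0 : u = 0
  · subst hu0
    have : unit.reflection ((0 : R4) : S4) = OnePoint.infty := unit.reflectionFun_center
    rw [this, hinf, finiteChart_coe]
    simp
  · have hpos : 0 < ‖u‖ := norm_pos_iff.2 hu0
    have hn : ‖(‖u‖ ^ 2)⁻¹ • u - c‖ ^ 2 = den u / ‖u‖ ^ 2 := by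
      rw [@norm_sub_sq_real, norm_smul, real_inner_smul_left, mul_pow, norm_inv, norm_pow,
        norm_norm, hden]
      field_simp
    have hyc : (‖u‖ ^ 2)⁻¹ • u ≠ c := by
      intro h
      rw [h, sub_self, norm_zero, zero_pow two_ne_zero] at hn
      exact div_ne_zero hu (by positivity) hn.symm
    have e := B.reflectionFun_coe hyc
    rw [unit_reflection_coe hu0, reflection_apply, e, finiteChart_coe, inversion_formula, ← hc, hn]
    congr 1
    rw [smul_sub, smul_add, smul_smul, smul_smul, smul_smul, smul_neg, sub_eq_add_neg]
    congr 2
    · field_simp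
    · congr 1
      field_simp

lemma contMDiffAt_reflection_center (B : RoundBall) :
    ContMDiffAt 𝓘(ℝ, R4) 𝓘(ℝ, R4) ∞ B.reflection (B.center : S4) ∧
      IsConformalMap (sphereDeriv B.reflection (B.center : S4)) := by
  have hr := B.radius_pos
  set c := B.center with hc
  have hcen : B.reflection (c : S4) = OnePoint.infty := B.reflectionFun_center
  set den : R4 → ℝ := fun u => B.radius ^ 4 + 2 * B.radius ^ 2 * Inner.inner ℝ u c +
    ‖u‖ ^ 2 * ‖c‖ ^ 2 with hden
  have hden1 : ContDiff ℝ ∞ den := by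
    have h1 : ContDiff ℝ ∞ fun u : R4 => ‖u‖ ^ 2 := contDiff_norm_sq ℝ
    have h2 : ContDiff ℝ ∞ fun u : R4 => (Inner.inner ℝ u c : ℝ) :=
      contDiff_id.inner ℝ contDiff_const
    exact (contDiff_const.add (contDiff_const.mul h2)).add (h1.mul contDiff_const)
  have hden0 : den 0 = B.radius ^ 4 := by simp [hden]
  have hden0' : den 0 ≠ 0 := by rw [hden0]; positivity
  have hsub : Tendsto (fun y : R4 => y - c) (𝓝 c) (𝓝 0) := by
    have : Continuous fun y : R4 => y - c := by fun_prop
    simpa using this.tendsto c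
  have hne : ∀ᶠ y in 𝓝 c, den (y - c) ≠ 0 :=
    hsub.eventually (hden1.continuous.continuousAt.eventually_ne hden0')
  have hk : ContDiffAt ℝ ∞ (fun u => 1 / den u) 0 :=
    contDiffAt_const.div hden1.contDiffAt hden0'
  set ψ : R4 → R4 := fun u => (1 / den u) • ((B.radius ^ 2) • u + ‖u‖ ^ 2 • c) with hψ
  have hψ1 : ContDiffAt ℝ ∞ ψ 0 :=
    hk.smul (contDiff_quadratic _ _).contDiffAt
  have hψ2 := hasFDerivAt_smul_quadratic (hk.differentiableAt (by simp)) (B.radius ^ 2) c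
  have hs0 : c - c = 0 := sub_self c
  have hψ3 : ContDiffAt ℝ ∞ ψ (c - c) := by rw [hs0]; exact hψ1
  refine contMDiffAt_and_isConformalMap (φ := fun y => ψ (y - c)) (z := c)
    (by rw [chartAt_coe, finiteChart_coe]) B.reflection.continuous.continuousAt ?_
    (ContDiffAt.comp (g := ψ) (f := fun y => y - c) c hψ3 (contDiffAt_id.sub contDiffAt_const))
    (L := (1 / den 0 * B.radius ^ 2) • ContinuousLinearMap.id ℝ R4) ?_
    (isConformalMap_const_smul (by rw [hden0]; positivity))
  · rw [hcen, chartAt_coe, chartAt_infty]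
    filter_upwards [hne] with y hy
    rw [finiteChart_symm, inftyChart_apply]
    by_cases hyc : y = c
    · rw [hyc, hcen]
      have : unit.reflection (OnePoint.infty : S4) = ((0 : R4) : S4) := rfl
      rw [this, finiteChart_coe]
      simp [hψ]
    · have hpos : 0 < ‖y - c‖ := norm_pos_iff.2 (sub_ne_zero.2 hyc)
      have e : B.reflection (y : S4) = _ := B.reflectionFun_coe hyc
      have hn : ‖EuclideanGeometry.inversion c B.radius y‖ ^ 2 = den (y - c) / ‖y - c‖ ^ 2 := by
        rw [inversion_formula, @norm_add_sq_real, norm_smul, real_inner_smul_left, mul_pow,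
          Real.norm_eq_abs, sq_abs, hden]
        field_simp
      have hi0 : EuclideanGeometry.inversion c B.radius y ≠ 0 := by
        intro h
        rw [h, norm_zero, zero_pow two_ne_zero] at hn
        exact div_ne_zero hy (by positivity) hn.symm
      rw [e, unit_reflection_coe hi0, finiteChart_coe, hn,
        inversion_formula, hψ]
      simp only [smul_add, smul_smul]
      congr 2
      · field_simp
      · field_simp
  · have h1 : HasFDerivAt (fun y : R4 => y - c) (ContinuousLinearMap.id ℝ R4) c :=
      (hasFDerivAt_id c).sub_const c
    have h2 : HasFDerivAt ψ ((1 / den 0 * B.radius ^ 2) • ContinuousLinearMap.id ℝ R4) (c - c) := by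
      rw [hs0]; exact hψ2
    exact (HasFDerivAt.comp (g := ψ) (f := fun y => y - c) c h2 h1).congr_fderiv (by ext v; simp)

lemma contMDiffAt_reflection_coe (B : RoundBall) {y : R4} (hy : y ≠ B.center) :
    ContMDiffAt 𝓘(ℝ, R4) 𝓘(ℝ, R4) ∞ B.reflection (y : S4) ∧
      IsConformalMap (sphereDeriv B.reflection (y : S4)) := by
  have hd := dist_pos.2 hy
  have hr := B.radius_pos
  have e : ∀ z : R4, z ≠ B.center → B.reflection (z : S4) =
    ((EuclideanGeometry.inversion B.center B.radius z : R4) : S4) := fun z => B.reflectionFun_coe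
  refine contMDiffAt_and_isConformalMap (φ := EuclideanGeometry.inversion B.center B.radius)
    (z := y) (by rw [chartAt_coe, finiteChart_coe]) B.reflection.continuous.continuousAt ?_
    (contDiffAt_const.inversion contDiffAt_const contDiffAt_id hy)
    (EuclideanGeometry.hasFDerivAt_inversion hy)
    ((LinearIsometry.isConformalMap (LinearIsometryEquiv.toLinearIsometry _)).smul (by positivity))
  rw [e y hy, chartAt_coe, chartAt_coe]
  filter_upwards [isOpen_ne.mem_nhds hy] with z hz
  rw [finiteChart_symm, e z hz, finiteChart_coe]

lemma isMobius_reflection (B : RoundBall) : IsMobius B.reflection := by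
  have h : ∀ x, ContMDiffAt 𝓘(ℝ, R4) 𝓘(ℝ, R4) ∞ B.reflection x ∧
      IsConformalMap (sphereDeriv B.reflection x) := by
    intro x
    induction x using OnePoint.rec with
    | infty => exact B.contMDiffAt_reflection_infty
    | coe y =>
      by_cases hy : y = B.center
      · rw [hy]; exact B.contMDiffAt_reflection_center
      · exact B.contMDiffAt_reflection_coe hy
  exact ⟨fun x => (h x).1, fun x => (h x).1, fun x => (h x).2⟩

end RoundBall

lemma isMobius_one : IsMobius 1 := by
  refine ⟨contMDiff_id, contMDiff_id, fun x => ?_⟩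
  have : sphereDeriv (1 : S4 ≃ₜ S4) x = ContinuousLinearMap.id ℝ R4 := mfderiv_id
  rw [this]
  exact isConformalMap_id

lemma IsMobius.mul {g h : S4 ≃ₜ S4} (hg : IsMobius g) (hh : IsMobius h) : IsMobius (g * h) := by
  refine ⟨hg.1.comp hh.1, hh.2.1.comp hg.2.1, fun x => ?_⟩
  have : sphereDeriv (g * h : S4 ≃ₜ S4) x = (sphereDeriv g (h x)).comp (sphereDeriv h x) :=
    mfderiv_comp x ((hg.1 _).mdifferentiableAt (by simp)) ((hh.1 _).mdifferentiableAt (by simp))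
  rw [this]
  exact (hg.2.2 _).comp (hh.2.2 _)

/-- Since reflections are involutions, the group is generated by them as a monoid, so inverses of
Möbius transformations need not be considered. -/
lemma isMobius_of_mem_reflectionGroup {ι : Type} {p : ι → RoundBall} {g : S4 ≃ₜ S4}
    (hg : g ∈ reflectionGroup p) : IsMobius g := by
  rw [reflectionGroup, ← Subgroup.mem_toSubmonoid, Subgroup.closure_toSubmonoid] at hg
  induction hg using Submonoid.closure_induction with
  | mem x hx =>
    obtain ⟨j, rfl⟩ | ⟨j, hj⟩ := hx
    · exact (p j).isMobius_reflection
    · have : x = (p j).reflection := by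
        rw [← inv_inv x, ← hj]
        exact RoundBall.reflection_inv
      rw [this]
      exact (p j).isMobius_reflection
  | one => exact isMobius_one
  | mul x y _ _ hx hy => exact hx.mul hy

section

/-! ### Corners and faces of the closed exterior -/

/-- The power of a point with respect to the sphere, with value `1` at `∞`. -/
def RoundBall.power (B : RoundBall) (x : S4) : ℝ :=
  x.elim 1 fun y => ‖y - B.center‖ ^ 2 - B.radius ^ 2

namespace RoundBall

variable {B : RoundBall}

lemma power_coe (y : R4) : B.power (y : S4) = ‖y - B.center‖ ^ 2 - B.radius ^ 2 := rfl

lemma power_nonneg_iff {x : S4} : 0 ≤ B.power x ↔ x ∉ B.cap := by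
  induction x using OnePoint.rec with
  | infty =>
    have : OnePoint.infty ∉ B.cap := fun h => infty_notMem_closedCap (cap_subset_closedCap h)
    exact ⟨fun _ => this, fun _ => zero_le_one' ℝ⟩
  | coe y =>
    rw [coe_mem_cap, not_lt, power_coe, sub_nonneg, dist_eq_norm,
      pow_le_pow_iff_left₀ B.radius_pos.le (norm_nonneg _) two_ne_zero]

lemma power_eq_zero_iff {x : S4} : B.power x = 0 ↔ x ∈ B.rim := by
  induction x using OnePoint.rec with
  | infty =>
    have : OnePoint.infty ∉ B.rim := fun h => infty_notMem_closedCap (rim_subset_closedCap h)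
    exact ⟨fun h => absurd h (one_ne_zero' ℝ), fun h => absurd h this⟩
  | coe y =>
    rw [coe_mem_rim, power_coe, sub_eq_zero, dist_eq_norm,
      pow_left_inj₀ (norm_nonneg _) B.radius_pos.le two_ne_zero]

lemma contMDiffAt_power (x : R4) :
    ContMDiffAt 𝓘(ℝ, R4) 𝓘(ℝ, ℝ) ∞ B.power (x : S4) ∧
      scalarDeriv B.power (x : S4) = innerSL ℝ ((2 : ℝ) • (x - B.center)) := by
  have hφ : ContDiff ℝ ∞ fun y : R4 => ‖y - B.center‖ ^ 2 - B.radius ^ 2 :=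
    ((contDiff_id.sub contDiff_const).norm_sq ℝ).sub contDiff_const
  have h := contMDiffAt_and_scalarDeriv (f := B.power) (fun y => power_coe y) hφ x
  refine ⟨h.1, h.2.trans ?_⟩
  have h1 : HasFDerivAt (fun y : R4 => y - B.center) (ContinuousLinearMap.id ℝ R4) x :=
    (hasFDerivAt_id x).sub_const _
  rw [(h1.norm_sq.sub_const _).fderiv]
  ext v
  simp

end RoundBall

variable {ι : Type} {p : ι → RoundBall}

lemma eventually_isRegularPoint_iff [Finite ι] {x : S4} (hx : IsRegularPoint p x) :
    ∀ᶠ y in 𝓝 x, IsRegularPoint p y ↔ ∀ j, x ∈ (p j).rim → 0 ≤ (p j).power y := by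
  filter_upwards [eventually_mem_closedCap_imp_mem_rim hx.1] with y hy
  constructor
  · exact fun h j _ => RoundBall.power_nonneg_iff.2 (mem_closedExterior.1 h.1 j)
  · intro h
    refine ⟨mem_closedExterior.2 fun j hj => ?_, fun i j hij hi hj => ?_⟩
    · exact RoundBall.power_nonneg_iff.1 (h j (hy j (RoundBall.cap_subset_closedCap hj))) hj
    · exact hx.2 i j hij (hy i (RoundBall.rim_subset_closedCap hi))
        (hy j (RoundBall.rim_subset_closedCap hj))

lemma IsRegularPoint.inner_eq_zero {x : R4} (hx : IsRegularPoint p (x : S4)) {i j : ι}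
    (hij : i ≠ j) (hi : (x : S4) ∈ (p i).rim) (hj : (x : S4) ∈ (p j).rim) :
    Inner.inner ℝ (x - (p i).center) (x - (p j).center) = 0 :=
  (hx.2 i j hij hi hj).inner_sub_center (RoundBall.coe_mem_rim.1 hi) (RoundBall.coe_mem_rim.1 hj)

lemma norm_sub_center_of_mem_rim {B : RoundBall} {x : R4} (hx : (x : S4) ∈ B.rim) :
    ‖x - B.center‖ = B.radius := by
  rw [← dist_eq_norm, RoundBall.coe_mem_rim.1 hx]

/-- A set which near a regular point is cut out by powers with respect to spheres through that point
is a submanifold with corners: the gradients of the powers are orthogonal. -/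
lemma IsRegularPoint.isCornerSubmanifoldAt {x : R4} (hx : IsRegularPoint p (x : S4)) {k q : ℕ}
    (e : Fin k ⊕ Fin q → ι) (he : Function.Injective e) (hr : ∀ a, (x : S4) ∈ (p (e a)).rim)
    {S : Set S4} (hS : ∀ᶠ y in 𝓝 (x : S4), y ∈ S ↔
      (∀ i, (p (e (.inl i))).power y = 0) ∧ ∀ j, 0 ≤ (p (e (.inr j))).power y) :
    IsCornerSubmanifoldAt k S (x : S4) := by
  refine ⟨q, fun i => (p (e (.inl i))).power, fun j => (p (e (.inr j))).power,
    fun i => ⟨RoundBall.power_eq_zero_iff.2 (hr _), (RoundBall.contMDiffAt_power x).1⟩,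
    fun j => ⟨RoundBall.power_eq_zero_iff.2 (hr _), (RoundBall.contMDiffAt_power x).1⟩, ?_, hS⟩
  have hli : LinearIndependent ℝ fun a => (2 : ℝ) • (x - (p (e a)).center) := by
    refine linearIndependent_of_ne_zero_of_inner_eq_zero (𝕜 := ℝ) (fun a => ?_) fun a b hab => ?_
    · have h1 := norm_sub_center_of_mem_rim (hr a)
      have h2 := (p (e a)).radius_pos
      refine smul_ne_zero two_ne_zero fun h => ?_
      rw [h, norm_zero] at h1
      exact h2.ne h1
    · change Inner.inner ℝ _ _ = (0 : ℝ)
      rw [real_inner_smul_left, real_inner_smul_right,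
        hx.inner_eq_zero (he.ne hab) (hr a) (hr b), mul_zero, mul_zero]
  have hmap := hli.map' (innerSL ℝ : R4 →L[ℝ] R4 →L[ℝ] ℝ).toLinearMap
    (LinearMap.ker_eq_bot.2 fun v w h => (InnerProductSpace.toDual ℝ R4).injective (by
      ext z; exact congrArg (fun L : R4 →L[ℝ] ℝ => L z) h))
  have heq : Sum.elim (fun i => scalarDeriv (p (e (.inl i))).power (x : S4))
      (fun j => scalarDeriv (p (e (.inr j))).power (x : S4)) =
        fun a => innerSL ℝ ((2 : ℝ) • (x - (p (e a)).center)) := by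
    funext a
    obtain i | j := a
    · exact (RoundBall.contMDiffAt_power x).2
    · exact (RoundBall.contMDiffAt_power x).2
  rw [heq]
  exact hmap

variable (p) in
/-- The face of the closed exterior on the sphere with index `s`. -/
def face (s : ι) : Set S4 := {x | IsRegularPoint p x ∧ x ∈ (p s).rim}

lemma isCornerSubmanifoldAt_regular [Finite ι] {x : S4} (hx : IsRegularPoint p x) :
    IsCornerSubmanifoldAt 0 {y | IsRegularPoint p y} x := by
  induction x using OnePoint.rec with
  | infty =>
    refine ⟨0, Fin.elim0, Fin.elim0, fun i => i.elim0, fun i => i.elim0,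
      linearIndependent_empty_type, ?_⟩
    filter_upwards [isOpen_exterior.mem_nhds (infty_mem_exterior (p := p))] with y hy
    exact ⟨fun _ => ⟨fun i => i.elim0, fun i => i.elim0⟩, fun _ => isRegularPoint_of_mem_exterior hy⟩
  | coe x =>
    obtain ⟨q, ⟨e⟩⟩ := Finite.exists_equiv_fin {j // (x : S4) ∈ (p j).rim}
    refine hx.isCornerSubmanifoldAt (q := q) (Sum.elim Fin.elim0 fun a => (e.symm a : ι)) ?_ ?_ ?_
    · rintro (i | a) (j | b) h
      · exact i.elim0
      · exact i.elim0
      · exact j.elim0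
      · exact congrArg _ (e.symm.injective (Subtype.ext h))
    · rintro (i | a)
      · exact i.elim0
      · exact (e.symm a).2
    · filter_upwards [eventually_isRegularPoint_iff hx] with y hy
      refine hy.trans ⟨fun h => ⟨fun i => i.elim0, fun a => h _ (e.symm a).2⟩, fun h j hj => ?_⟩
      simpa using h.2 (e ⟨j, hj⟩)

lemma isCornerSubmanifoldAt_face [Finite ι] {s : ι} {x : S4} (hx : x ∈ face p s) :
    IsCornerSubmanifoldAt 1 (face p s) x := by
  obtain ⟨hx, hs⟩ := hx
  obtain ⟨x, -, rfl⟩ := id hs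
  obtain ⟨q, ⟨e⟩⟩ := Finite.exists_equiv_fin {j // (x : S4) ∈ (p j).rim ∧ j ≠ s}
  refine hx.isCornerSubmanifoldAt (q := q) (Sum.elim (fun _ => s) fun a => (e.symm a : ι)) ?_ ?_ ?_
  · rintro (i | a) (j | b) h
    · exact congrArg _ (Subsingleton.elim i j)
    · exact absurd h.symm (e.symm b).2.2
    · exact absurd h (e.symm a).2.2
    · exact congrArg _ (e.symm.injective (Subtype.ext h))
  · rintro (i | a)
    · exact hs
    · exact (e.symm a).2.1
  · filter_upwards [eventually_isRegularPoint_iff hx] with y hy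
    constructor
    · rintro ⟨h1, h2⟩
      exact ⟨fun _ => RoundBall.power_eq_zero_iff.2 h2, fun a => hy.1 h1 _ (e.symm a).2.1⟩
    · rintro ⟨h1, h2⟩
      refine ⟨hy.2 fun j hj => ?_, RoundBall.power_eq_zero_iff.1 (h1 0)⟩
      by_cases hjs : j = s
      · rw [hjs]
        exact (h1 0).ge
      · simpa using h2 (e ⟨j, hj, hjs⟩)

/-- At a common point of two faces, one leaves the second one within the first along the great
circle of the first sphere in the direction away from the centre of the second. -/
lemma face_subset_closure_diff [Finite ι] {s t : ι} (hst : s ≠ t) :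
    face p s ⊆ closure (face p s \ face p t) := by
  rintro x ⟨hx, hs⟩
  by_cases ht : x ∈ (p t).rim
  swap
  · exact subset_closure ⟨⟨hx, hs⟩, fun h => ht h.2⟩
  obtain ⟨x, -, rfl⟩ := id hs
  set k := (p s).radius / (p t).radius with hk
  have hrs := (p s).radius_pos
  have hrt := (p t).radius_pos
  have hkpos : 0 < k := by positivity
  set γ : ℝ → R4 := fun θ => x + (Real.cos θ - 1) • (x - (p s).center) +
    (Real.sin θ * k) • (x - (p t).center) with hγ
  have hc : Tendsto (fun θ => (γ θ : S4)) (𝓝[>] 0) (𝓝 (x : S4)) := by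
    have : Continuous fun θ => (γ θ : S4) :=
      OnePoint.continuous_coe.comp (by fun_prop)
    have h := this.tendsto 0
    have h0 : γ 0 = x := by simp [hγ]
    rw [h0] at h
    exact h.mono_left nhdsWithin_le_nhds
  refine mem_closure_of_tendsto hc ?_
  have hpi : ∀ᶠ θ in 𝓝[>] (0 : ℝ), θ < Real.pi :=
    (eventually_lt_nhds Real.pi_pos).filter_mono nhdsWithin_le_nhds
  filter_upwards [hc.eventually (eventually_isRegularPoint_iff hx), self_mem_nhdsWithin, hpi]
    with θ hreg hθ0 hθ1
  have hsin : 0 < Real.sin θ := Real.sin_pos_of_pos_of_lt_pi hθ0 hθ1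
  have hu := norm_sub_center_of_mem_rim hs
  have hv := norm_sub_center_of_mem_rim ht
  have huv := hx.inner_eq_zero hst hs ht
  set u := x - (p s).center with hudef
  set v := x - (p t).center with hvdef
  have hnorm : ∀ a b : ℝ, ‖a • u + b • v‖ ^ 2 =
      a ^ 2 * (p s).radius ^ 2 + b ^ 2 * (p t).radius ^ 2 := fun a b => by
    rw [@norm_add_sq_real, real_inner_smul_left, real_inner_smul_right, huv, norm_smul, norm_smul,
      hu, hv, Real.norm_eq_abs, Real.norm_eq_abs, mul_pow, mul_pow, sq_abs, sq_abs]
    ring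
  have hps : (p s).power (γ θ : S4) = 0 := by
    have e : γ θ - (p s).center = Real.cos θ • u + (Real.sin θ * k) • v := by
      simp only [hγ, hudef]; module
    rw [RoundBall.power_coe, e, hnorm, mul_pow, hk, div_pow]
    field_simp
    have := Real.sin_sq_add_cos_sq θ
    linear_combination (p s).radius ^ 2 * this
  have hpt : 0 < (p t).power (γ θ : S4) := by
    have e : γ θ - (p t).center = (Real.cos θ - 1) • u + (1 + Real.sin θ * k) • v := by
      simp only [hγ, hvdef]; module
    rw [RoundBall.power_coe, e, hnorm]
    have h1 : 0 < Real.sin θ * k := by positivity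
    have h2 : 0 < (Real.sin θ * k) * (p t).radius ^ 2 := by positivity
    nlinarith [sq_nonneg ((Real.cos θ - 1) * (p s).radius),
      sq_nonneg (Real.sin θ * k * (p t).radius)]
  refine ⟨⟨hreg.2 fun j hj => ?_, RoundBall.power_eq_zero_iff.1 hps⟩, fun h =>
    hpt.ne' (RoundBall.power_eq_zero_iff.2 h.2)⟩
  by_cases hjs : j = s
  · rw [hjs, hps]
  by_cases hjt : j = t
  · rw [hjt]; exact hpt.le
  have e : γ θ - (p j).center = (x - (p j).center) +
      ((Real.cos θ - 1) • u + (Real.sin θ * k) • v) := by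
    simp only [hγ]; module
  rw [RoundBall.power_coe, e, @norm_add_sq_real, inner_add_right, real_inner_smul_right,
    real_inner_smul_right, hx.inner_eq_zero hjs hj hs, hx.inner_eq_zero hjt hj ht,
    norm_sub_center_of_mem_rim hj]
  nlinarith [sq_nonneg ‖(Real.cos θ - 1) • u + (Real.sin θ * k) • v‖]

/-! ### The fundamental domain -/

lemma frontier_exterior_inter_discontinuitySet [Finite ι] (hp : IsRightAngled p) :
    frontier (exterior p) ∩ discontinuitySet (reflectionGroup p) = ⋃ s, face p s := by
  have h : frontier (exterior p) ∩ discontinuitySet (reflectionGroup p) =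
      {x | IsRegularPoint p x} \ exterior p := by
    rw [← closure_exterior_inter_discontinuitySet hp, isOpen_exterior.frontier_eq,
      inter_comm, inter_comm (closure _), inter_sdiff_assoc]
  rw [h]
  ext x
  simp only [Set.mem_sdiff, mem_ofPred_eq, mem_iUnion, face, mem_exterior]
  push Not
  constructor
  · rintro ⟨hx, j, hj⟩
    exact ⟨j, hx, (mem_closedCap_iff_mem_rim hx.1 j).1 hj⟩
  · rintro ⟨j, hx, hj⟩
    exact ⟨hx, j, RoundBall.rim_subset_closedCap hj⟩

lemma iUnion_image_closure_exterior [Finite ι] (hp : IsRightAngled p) :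
    ⋃ g ∈ reflectionGroup p,
      g '' (closure (exterior p) ∩ discontinuitySet (reflectionGroup p)) =
        discontinuitySet (reflectionGroup p) := by
  apply Subset.antisymm
  · refine iUnion₂_subset fun g hg => ?_
    rintro _ ⟨x, ⟨-, hx⟩, rfl⟩
    exact apply_mem_discontinuitySet hg hx
  · intro x hx
    obtain ⟨g, hg, hgx⟩ := exists_apply_mem_closedExterior hp hx
    refine mem_iUnion₂.2 ⟨g⁻¹, inv_mem hg, g x, ?_, g.symm_apply_apply x⟩
    rw [closure_exterior_inter_discontinuitySet hp]
    exact isRegularPoint_of_mem hp hgx (apply_mem_discontinuitySet hg hx)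

lemma finite_image_exterior_inter [Finite ι] (hp : IsRightAngled p) {K : Set S4}
    (hK : IsCompact K) (hKΩ : K ⊆ discontinuitySet (reflectionGroup p)) :
    {g : S4 ≃ₜ S4 | g ∈ reflectionGroup p ∧ (g '' exterior p ∩ K).Nonempty}.Finite := by
  refine hK.induction_on (p := fun K => {g : S4 ≃ₜ S4 | g ∈ reflectionGroup p ∧
    (g '' exterior p ∩ K).Nonempty}.Finite) (by simp) (fun s t hst ht => ht.subset ?_)
    (fun s t hs ht => (hs.union ht).subset ?_) fun x hx => ?_
  · rintro g ⟨hg, h⟩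
    exact ⟨hg, h.mono (inter_subset_inter_right _ hst)⟩
  · rintro g ⟨hg, h⟩
    rw [inter_union_distrib_left, union_nonempty] at h
    exact h.imp (fun h => ⟨hg, h⟩) fun h => ⟨hg, h⟩
  · obtain ⟨h, hh, hhx⟩ := exists_apply_mem_closedExterior hp (hKΩ hx)
    obtain ⟨V, hV, hfin, -⟩ := (isRegularPoint_of_mem hp hhx
      (apply_mem_discontinuitySet hh (hKΩ hx))).exists_nhds hp
    refine ⟨h ⁻¹' V, mem_nhdsWithin_of_mem_nhds (h.continuous.continuousAt hV),
      (hfin.preimage (f := fun g => h * g) (mul_right_injective h).injOn).subset ?_⟩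
    rintro g ⟨hg, _, ⟨d, hd, rfl⟩, hy⟩
    exact ⟨mul_mem hh hg, h (g d), ⟨d, hd, rfl⟩, hy⟩

/-- The exterior of a right-angled family is a fundamental domain of the reflection group. -/
theorem isFundamentalDomain_exterior [Finite ι] (hp : IsRightAngled p) :
    IsFundamentalDomain (reflectionGroup p) (exterior p) where
  subset x hx := ((closure_exterior_inter_discontinuitySet hp).ge
    (isRegularPoint_of_mem_exterior hx)).2
  subset_closure_interior := by
    rw [isOpen_exterior.interior_eq]
    exact subset_closure
  piecewise_smooth x hx := by
    rw [closure_exterior_inter_discontinuitySet hp] at hx ⊢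
    exact isCornerSubmanifoldAt_regular hx
  cover := iUnion_image_closure_exterior hp
  disjoint g hg h1 := by
    rw [isOpen_exterior.interior_eq, disjoint_left]
    rintro _ ⟨x, hx, rfl⟩ hgx
    exact h1 (eq_one_of_mem_exterior hp hg hx hgx)
  faces := by
    refine ⟨ι, face p, id, fun s => (p s).reflection,
      (frontier_exterior_inter_discontinuitySet hp).symm, fun s x hΩ hx => ?_,
      fun s x hx => isCornerSubmanifoldAt_face hx, fun s t hst => face_subset_closure_diff hst,
      fun x _ => ⟨univ, univ_mem, Set.toFinite _⟩, fun s =>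
        ⟨reflection_mem_reflectionGroup s, RoundBall.reflection_ne_one, ?_, rfl,
          RoundBall.reflection_inv.symm⟩⟩
    · have h1 : face p s ⊆ closedExterior p ∩ (p s).rim := fun y hy => ⟨hy.1.1, hy.2⟩
      have h2 := closure_minimal h1 (isClosed_closedExterior.inter RoundBall.isClosed_rim) hx
      exact ⟨isRegularPoint_of_mem hp h2.1 hΩ, h2.2⟩
    · have : EqOn (p s).reflection id (face p s) := fun x hx =>
        RoundBall.reflection_of_mem_rim hx.2
      rw [this.image_eq, image_id, id]
  locally_finite K hK hKΩ := finite_image_exterior_inter hp hK hKΩ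

theorem isKleinian_reflectionGroup [Finite ι] (hp : IsRightAngled p) :
    IsKleinian (reflectionGroup p) where
  mobius _ hg := isMobius_of_mem_reflectionGroup hg
  discrete := isDiscreteGroup_reflectionGroup hp
  nonempty := ⟨OnePoint.infty, (isFundamentalDomain_exterior hp).subset infty_mem_exterior⟩

end

section

/-! ### The pearls of a necklace form a right-angled family -/

lemma rotate_zero (x : R4) : rotate 0 x = x := by
  ext j
  fin_cases j <;> simp [rotate]

/-- The law of cosines for rotated points of the half-space. -/
lemma dist_rotate_sq {x y : R4} (hx : x ∈ halfSpace) (hy : y ∈ halfSpace) (θ φ : ℝ) :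
    dist (rotate θ x) (rotate φ y) ^ 2 =
      dist x y ^ 2 + 2 * (x 2 * y 2) * (1 - Real.cos (θ - φ)) := by
  have e : ∀ a b : R4, dist a b ^ 2 = ∑ j, (a j - b j) ^ 2 := fun a b => by
    rw [dist_eq_norm, EuclideanSpace.real_norm_sq_eq]; rfl
  rw [e, e, Fin.sum_univ_four, Fin.sum_univ_four, Real.cos_sub]
  simp only [rotate, PiLp.toLp_apply, Matrix.cons_val, hx.2, hy.2]
  have h1 := Real.sin_sq_add_cos_sq θ
  have h2 := Real.sin_sq_add_cos_sq φ
  linear_combination x 2 ^ 2 * h1 + y 2 ^ 2 * h2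

/-- Twice the cosine of the angle of a meridian. -/
def twiceCos : ZMod 6 → ℤ := ![2, 1, -1, -2, -1, 1]

/-- The sine of the angle of a meridian, divided by `√3 / 2`. -/
def scaledSin : ZMod 6 → ℤ := ![0, 1, 1, 0, -1, -1]

lemma cos_meridianAngle (i : ZMod 6) : Real.cos (meridianAngle i) = twiceCos i / 2 ∧
    Real.sin (meridianAngle i) = Real.sqrt 3 / 2 * scaledSin i := by
  have e1 : meridianAngle i = i.val * (Real.pi / 3) := by
    rw [meridianAngle]; ring
  have e2 : 2 * (Real.pi / 3) = Real.pi - Real.pi / 3 := by ring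
  have e3 : 3 * (Real.pi / 3) = Real.pi := by ring
  have e4 : 4 * (Real.pi / 3) = Real.pi / 3 + Real.pi := by ring
  have e5 : 5 * (Real.pi / 3) = 2 * Real.pi - Real.pi / 3 := by ring
  rw [e1]
  fin_cases i
  · simp [ZMod.val, twiceCos, scaledSin]
  · simp [ZMod.val, twiceCos, scaledSin]
  · simp [ZMod.val, twiceCos, scaledSin, e2]
    ring
  · simp [ZMod.val, twiceCos, scaledSin, e3]
  · simp [ZMod.val, twiceCos, scaledSin, e4, Real.cos_add_pi, Real.sin_add_pi]
    ring
  · simp [ZMod.val, twiceCos, scaledSin, e5, Real.cos_two_pi_sub, Real.sin_two_pi_sub]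

lemma four_mul_cos_meridianAngle_sub (i j : ZMod 6) :
    4 * Real.cos (meridianAngle i - meridianAngle j) =
      (twiceCos i * twiceCos j + 3 * (scaledSin i * scaledSin j) : ℤ) := by
  have hs : Real.sqrt 3 * Real.sqrt 3 = 3 := Real.mul_self_sqrt (by norm_num)
  rw [Real.cos_sub, (cos_meridianAngle i).1, (cos_meridianAngle j).1, (cos_meridianAngle i).2,
    (cos_meridianAngle j).2]
  push_cast
  linear_combination (scaledSin i * scaledSin j : ℝ) * hs

lemma cos_meridianAngle_sub_add_one (i : ZMod 6) :
    Real.cos (meridianAngle i - meridianAngle (i + 1)) = 1 / 2 := by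
  have h : ∀ i, twiceCos i * twiceCos (i + 1) + 3 * (scaledSin i * scaledSin (i + 1)) = 2 := by
    decide
  have := four_mul_cos_meridianAngle_sub i (i + 1)
  rw [h] at this
  push_cast at this
  linarith

lemma cos_meridianAngle_sub_le {i j : ZMod 6} (hij : i ≠ j) :
    Real.cos (meridianAngle i - meridianAngle j) ≤ 1 / 2 := by
  have h : ∀ i j, i ≠ j → twiceCos i * twiceCos j + 3 * (scaledSin i * scaledSin j) ≤ 2 := by
    decide
  have h1 := four_mul_cos_meridianAngle_sub i j
  have h2 : ((twiceCos i * twiceCos j + 3 * (scaledSin i * scaledSin j) : ℤ) : ℝ) ≤ (2 : ℤ) :=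
    Int.cast_le.2 (h i j hij)
  push_cast at h1 h2
  linarith

lemma cos_meridianAngle_sub_le_neg {i j : ZMod 6} (hij : i ≠ j) (h1 : j ≠ i + 1)
    (h2 : i ≠ j + 1) : Real.cos (meridianAngle i - meridianAngle j) ≤ -(1 / 2) := by
  have h : ∀ i j, i ≠ j → j ≠ i + 1 → i ≠ j + 1 →
      twiceCos i * twiceCos j + 3 * (scaledSin i * scaledSin j) ≤ -2 := by
    decide
  have e1 := four_mul_cos_meridianAngle_sub i j
  have e2 : ((twiceCos i * twiceCos j + 3 * (scaledSin i * scaledSin j) : ℤ) : ℝ) ≤ (-2 : ℤ) :=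
    Int.cast_le.2 (h i j hij h1 h2)
  push_cast at e1 e2
  linarith

namespace RoundBall

lemma orthogonalOrSeparate_of_disjoint {B B' : RoundBall} (h : Disjoint B.solid B'.solid) :
    B.OrthogonalOrSeparate B' :=
  .inr ((disjoint_closedBall_closedBall_iff B.radius_pos.le B'.radius_pos.le).1 h).le

lemma orthogonalOrSeparate_of_sq_le {B B' : RoundBall}
    (h : (B.radius + B'.radius) ^ 2 ≤ dist B.center B'.center ^ 2) : B.OrthogonalOrSeparate B' :=
  .inr (le_of_sq_le_sq h dist_nonneg)

end RoundBall

namespace PearlNecklace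

open RoundBall

variable {m : ℕ} (N : PearlNecklace m)

/-- The ball of the semi-necklace of which the pearls of latitude `k` are the rotated copies. -/
abbrev base (k : Fin (m + 1)) : RoundBall := N.semi k.succ.castSucc

lemma base_center_mem (k : Fin (m + 1)) : (N.base k).center ∈ halfSpace :=
  N.isSemiNecklace.center_mem _

lemma dist_meridian_sq (k l : Fin (m + 1)) (i j : ZMod 6) :
    dist (N.pearl (.meridian k i)).center (N.pearl (.meridian l j)).center ^ 2 =
      dist (N.base k).center (N.base l).center ^ 2 +
        2 * ((N.base k).center 2 * (N.base l).center 2) *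
          (1 - Real.cos (meridianAngle i - meridianAngle j)) := by
  rw [N.meridian_eq, N.meridian_eq]
  exact dist_rotate_sq (N.base_center_mem k) (N.base_center_mem l) _ _

lemma radius_meridian (k : Fin (m + 1)) (i : ZMod 6) :
    (N.pearl (.meridian k i)).radius = (N.base k).radius := by
  rw [N.meridian_eq]; rfl

/-- Orthogonality of neighbouring copies determines the radius from the height of the centre. -/
lemma height_sq (k : Fin (m + 1)) : (N.base k).center 2 ^ 2 = 2 * (N.base k).radius ^ 2 := by
  have h := N.meridian_orthogonal k 0
  rw [Orthogonal, dist_meridian_sq, radius_meridian, radius_meridian,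
    cos_meridianAngle_sub_add_one, dist_self] at h
  linear_combination h

lemma height_mul (k l : Fin (m + 1)) :
    (N.base k).center 2 * (N.base l).center 2 = 2 * ((N.base k).radius * (N.base l).radius) := by
  have hk := (N.base_center_mem k).1
  have hl := (N.base_center_mem l).1
  have rk := (N.base k).radius_pos
  have rl := (N.base l).radius_pos
  refine (pow_left_inj₀ (by positivity) (by positivity) two_ne_zero).1 ?_
  rw [mul_pow, N.height_sq, N.height_sq]
  ring

lemma base_orthogonal {k l : Fin (m + 1)} (h : (k : ℕ) + 1 = l) :
    (N.base k).Orthogonal (N.base l) := by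
  have := N.isSemiNecklace.orthogonal k.succ
  have e : l.succ.castSucc = k.succ.succ := Fin.ext (by simp [← h])
  rw [base, base, e]
  exact this

lemma base_separate {k l : Fin (m + 1)} (h : (k : ℕ) + 1 < l) :
    (N.base k).radius + (N.base l).radius ≤ dist (N.base k).center (N.base l).center := by
  refine ((disjoint_closedBall_closedBall_iff (N.base k).radius_pos.le
    (N.base l).radius_pos.le).1 (N.isSemiNecklace.disjoint _ _ ?_)).le
  simpa using h

/-- Pearls on different meridians and neighbouring latitudes are tangent if the
meridians are adjacent, and disjoint otherwise. -/
lemma meridian_meridian_of_le {k l : Fin (m + 1)} (hkl : k ≤ l) {i j : ZMod 6}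
    (hne : (k, i) ≠ (l, j)) :
    (N.pearl (.meridian k i)).OrthogonalOrSeparate (N.pearl (.meridian l j)) := by
  have rk := (N.base k).radius_pos
  have rl := (N.base l).radius_pos
  have hd := N.dist_meridian_sq k l i j
  rw [height_mul] at hd
  have hrr : 0 < (N.base k).radius * (N.base l).radius := by positivity
  obtain h | h | h : k = l ∨ (k : ℕ) + 1 = l ∨ (k : ℕ) + 1 < l := by
    have : (k : ℕ) ≤ l := hkl
    rw [Fin.ext_iff]
    omega
  · subst h
    have hij : i ≠ j := fun h => hne (by rw [h])
    by_cases h1 : j = i + 1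
    · subst h1
      exact .inl (N.meridian_orthogonal k i)
    by_cases h2 : i = j + 1
    · subst h2
      exact .inl (N.meridian_orthogonal k j).symm
    have := cos_meridianAngle_sub_le_neg hij h1 h2
    refine orthogonalOrSeparate_of_sq_le ?_
    rw [hd, radius_meridian, radius_meridian, dist_self]
    nlinarith
  · have ho : dist (N.base k).center (N.base l).center ^ 2 = _ := N.base_orthogonal h
    rw [ho] at hd
    by_cases hij : i = j
    · subst hij
      left
      rw [Orthogonal, hd, radius_meridian, radius_meridian, sub_self, Real.cos_zero]
      ring
    have := cos_meridianAngle_sub_le hij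
    refine orthogonalOrSeparate_of_sq_le ?_
    rw [hd, radius_meridian, radius_meridian]
    nlinarith
  · have hs := N.base_separate h
    refine orthogonalOrSeparate_of_sq_le ?_
    rw [hd, radius_meridian, radius_meridian]
    have h1 : ((N.base k).radius + (N.base l).radius) ^ 2 ≤
      dist (N.base k).center (N.base l).center ^ 2 := by gcongr
    have := Real.cos_le_one (meridianAngle i - meridianAngle j)
    nlinarith

lemma meridian_meridian {k l : Fin (m + 1)} {i j : ZMod 6} (hne : (k, i) ≠ (l, j)) :
    (N.pearl (.meridian k i)).OrthogonalOrSeparate (N.pearl (.meridian l j)) := by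
  obtain h | h := le_total k l
  · exact N.meridian_meridian_of_le h hne
  · exact (N.meridian_meridian_of_le h hne.symm).symm

lemma arc_zero_axis : N.arc 0 2 = 0 ∧ N.arc 0 3 = 0 :=
  ⟨N.spinnable.endpoint_zero, (N.spinnable.mem_halfSpace 0 (by simp)).2⟩

lemma arc_one_axis : N.arc 1 2 = 0 ∧ N.arc 1 3 = 0 :=
  ⟨N.spinnable.endpoint_one, (N.spinnable.mem_halfSpace 1 (by simp)).2⟩

/-- A point of the axis has the same distance from all copies of a ball. -/
lemma dist_axis_meridian {x : R4} (h2 : x 2 = 0) (h3 : x 3 = 0) (k : Fin (m + 1)) (i : ZMod 6) :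
    dist x (N.pearl (.meridian k i)).center = dist x (N.base k).center := by
  have h := dist_rotate_sq (x := x) ⟨h2.ge, h3⟩ (N.base_center_mem k) 0 (meridianAngle i)
  rw [rotate_zero, h2, zero_mul, mul_zero, zero_mul, add_zero] at h
  rw [N.meridian_eq]
  exact (pow_left_inj₀ dist_nonneg dist_nonneg two_ne_zero).1 h

lemma pole_zero_eq : N.pearl (.pole 0) = N.semi 0 := by
  have hc : (N.pearl (.pole 0)).center = (N.semi 0).center := by
    rw [N.pole_zero_center, N.isSemiNecklace.center_first]
  have h1 := N.pole_zero_orthogonal 0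
  have h2 : (N.semi 0).Orthogonal (N.base 0) := N.isSemiNecklace.orthogonal 0
  have hx := N.arc_zero_axis
  rw [← N.pole_zero_center] at hx
  rw [Orthogonal, N.dist_axis_meridian hx.1 hx.2, hc, h2, radius_meridian] at h1
  have hr : (N.pearl (.pole 0)).radius = (N.semi 0).radius :=
    (pow_left_inj₀ (radius_pos _).le (radius_pos _).le two_ne_zero).1 (by linarith)
  cases h : N.pearl (.pole 0)
  cases h' : N.semi 0
  rw [h, h'] at hc hr
  simp_all

lemma pole_one_eq : N.pearl (.pole 1) = N.semi (Fin.last _) := by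
  have hc : (N.pearl (.pole 1)).center = (N.semi (Fin.last _)).center := by
    rw [N.pole_one_center, N.isSemiNecklace.center_last]
  have h1 := N.pole_one_orthogonal 0
  have h2 : (N.base (Fin.last m)).Orthogonal (N.semi (Fin.last _)) :=
    N.isSemiNecklace.orthogonal (Fin.last _)
  have h2 := h2.symm
  have hx := N.arc_one_axis
  rw [← N.pole_one_center] at hx
  rw [Orthogonal, N.dist_axis_meridian hx.1 hx.2, hc, h2, radius_meridian] at h1
  have hr : (N.pearl (.pole 1)).radius = (N.semi (Fin.last _)).radius :=
    (pow_left_inj₀ (radius_pos _).le (radius_pos _).le two_ne_zero).1 (by linarith)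
  cases h : N.pearl (.pole 1)
  cases h' : N.semi (Fin.last _)
  rw [h, h'] at hc hr
  simp_all

lemma pole_zero_pole_one :
    (N.pearl (.pole 0)).OrthogonalOrSeparate (N.pearl (.pole 1)) := by
  rw [pole_zero_eq, pole_one_eq]
  exact orthogonalOrSeparate_of_disjoint (N.isSemiNecklace.disjoint _ _ (by simp))

lemma pole_zero_meridian (k : Fin (m + 1)) (i : ZMod 6) :
    (N.pearl (.pole 0)).OrthogonalOrSeparate (N.pearl (.meridian k i)) := by
  by_cases hk : k = 0
  · subst hk
    exact .inl (N.pole_zero_orthogonal i)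
  have hx := N.arc_zero_axis
  rw [← N.pole_zero_center] at hx
  right
  rw [N.dist_axis_meridian hx.1 hx.2, radius_meridian, pole_zero_eq]
  refine ((disjoint_closedBall_closedBall_iff (radius_pos _).le
    (radius_pos _).le).1 (N.isSemiNecklace.disjoint _ _ ?_)).le
  have : (k : ℕ) ≠ 0 := fun h => hk (Fin.ext h)
  have e : (k.succ.castSucc : ℕ) = k + 1 := by simp
  rw [e, Fin.val_zero]
  omega

lemma pole_one_meridian (k : Fin (m + 1)) (i : ZMod 6) :
    (N.pearl (.pole 1)).OrthogonalOrSeparate (N.pearl (.meridian k i)) := by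
  by_cases hk : k = Fin.last m
  · subst hk
    exact .inl (N.pole_one_orthogonal i)
  have hx := N.arc_one_axis
  rw [← N.pole_one_center] at hx
  right
  rw [N.dist_axis_meridian hx.1 hx.2, radius_meridian, pole_one_eq]
  refine ((disjoint_closedBall_closedBall_iff (radius_pos _).le
    (radius_pos _).le).1 (N.isSemiNecklace.disjoint _ _ ?_).symm).le
  have h1 : (k : ℕ) ≠ m := fun h => hk (Fin.ext h)
  have h2 := k.is_lt
  simp
  omega

lemma joint_meridian (k : Fin m) (i : ZMod 6) (l : Fin (m + 1)) (j : ZMod 6) :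
    (N.pearl (.joint k i)).OrthogonalOrSeparate (N.pearl (.meridian l j)) := by
  by_cases h : l ∈ ({k.castSucc, k.succ} : Set (Fin (m + 1))) ∧ j ∈ ({i, i + 1} : Set (ZMod 6))
  · exact .inl (N.joint_orthogonal k i l h.1 j h.2)
  · exact orthogonalOrSeparate_of_disjoint (N.joint_disjoint_meridian k i l j h)

lemma pole_meridian (a : Fin 2) (k : Fin (m + 1)) (i : ZMod 6) :
    (N.pearl (.pole a)).OrthogonalOrSeparate (N.pearl (.meridian k i)) := by
  fin_cases a
  · exact N.pole_zero_meridian k i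
  · exact N.pole_one_meridian k i

lemma pole_pole {a b : Fin 2} (h : a ≠ b) :
    (N.pearl (.pole a)).OrthogonalOrSeparate (N.pearl (.pole b)) := by
  fin_cases a <;> fin_cases b
  · exact absurd rfl h
  · exact N.pole_zero_pole_one
  · exact N.pole_zero_pole_one.symm
  · exact absurd rfl h

theorem isRightAngled_pearl : IsRightAngled N.pearl := by
  rintro (⟨k, i⟩ | a | ⟨k, i⟩) (⟨l, j⟩ | b | ⟨l, j⟩) hne
  · exact N.meridian_meridian fun h => hne (by rw [Prod.mk.injEq] at h; rw [h.1, h.2])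
  · exact (N.pole_meridian b k i).symm
  · exact (N.joint_meridian l j k i).symm
  · exact N.pole_meridian a l j
  · exact N.pole_pole fun h => hne (by rw [h])
  · exact (orthogonalOrSeparate_of_disjoint (N.joint_disjoint_pole l j a)).symm
  · exact N.joint_meridian k i l j
  · exact orthogonalOrSeparate_of_disjoint (N.joint_disjoint_pole k i b)
  · exact orthogonalOrSeparate_of_disjoint (N.joint_disjoint_joint k i l j fun h =>
      hne (by rw [Prod.mk.injEq] at h; rw [h.1, h.2]))

end PearlNecklace

instance (m : ℕ) : Finite (PearlIndex m) := by
  let f : (Fin (m + 1) × ZMod 6) ⊕ Fin 2 ⊕ (Fin m × ZMod 6) → PearlIndex m :=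
    Sum.elim (fun a => .meridian a.1 a.2) (Sum.elim .pole fun a => .joint a.1 a.2)
  refine Finite.of_surjective f ?_
  rintro (⟨k, i⟩ | a | ⟨k, i⟩)
  · exact ⟨.inl (k, i), rfl⟩
  · exact ⟨.inr (.inl a), rfl⟩
  · exact ⟨.inr (.inr (k, i)), rfl⟩

end

end

theorem mainTheorem7 {m : ℕ} (N : PearlNecklace m) :
    IsKleinian N.group ∧
    IsFundamentalDomain N.group (N.filling)ᶜ ∧
    ∃ e : PresentedGroup N.relators ≃* N.group,
      ∀ j, (e (PresentedGroup.of j) : S4 ≃ₜ S4) = (N.pearl j).reflection :=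
  ⟨isKleinian_reflectionGroup N.isRightAngled_pearl,
    isFundamentalDomain_exterior N.isRightAngled_pearl,
    CoxeterQuotient.exists_mulEquiv N.isRightAngled_pearl⟩
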